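/- Let $\alpha\in(0,1)$ and $C_\alpha=\dfrac{\Gamma(\alpha/2)}{2^{1-\alpha}\,\Gamma\big(\frac{2-\alpha}{2}\big)}$. On the unit circle $\mathbb T\subset\mathbb C$ let $\int_{\mathbb T}f(\tau)\,d\tau$ denote complex integration over the positively oriented circle, and write $f'(w)=\frac{df}{dw}=-ie^{-i\eta}g'(\eta)$ for $w=e^{i\eta}$, $g(\eta)=f(e^{i\eta})$. For $0<\gamma<1$ let $C^\gamma(\mathbb T)$ be the space of continuous $f:\mathbb T\to\mathbb C$ with $$\|f\|_{C^\gamma}=\|f\|_{L^\infty}+\sup_{x\ne y}\frac{|f(x)-f(y)|}{|x-y|^\gamma}<\infty,$$ and let $C^{1+\gamma}(\mathbb T)$ be the space of $C^1$ functions with $f'\in C^\gamma(\mathbb T)$, normed by $\|f\|_{C^{1+\gamma}}=\|f\|_{L^\infty}+\|f'\|_{C^\gamma}$. Consider the real normed spaces $$X=\Big\{f\in C^{2-\alpha}(\mathbb T):\ f(w)=\sum_{n\ge0}b_n\overline w^{\,n},\ b_n\in\mathbb R\Big\},\qquad Y=\Big\{g\in C^{1-\alpha}(\mathbb T):\ g(w)=i\sum_{n\ge1}g_n\,(w^n-\overline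 w^{\,n}),\ g_n\in\mathbb R\Big\}$$ (the series being Fourier series), with the norms of $C^{2-\alpha}(\mathbb T)$ and $C^{1-\alpha}(\mathbb T)$, and let $B_r=\{f\in X:\|f\|_{C^{2-\alpha}}<r\}$. For $\Omega\in\mathbb R$ and $f\in B_r$ put, with $\phi(w)=w+f(w)$, $$F(\Omega,f)(w)=\mathrm{Im}\Big\{\Big(\Omega\,\phi(w)-\frac{C_\alpha}{2i\pi}\int_{\mathbb T}\frac{\phi'(\tau)}{|\phi(w)-\phi(\tau)|^\alpha}\,d\tau\Big)\,\overline w\,\overline{\phi'(w)}\Big\},\qquad w\in\mathbb T.$$ Then for every $r\in(0,1)$ the integrals converge absolutely, $F$ is a well-defined map $\mathbb R\times B_r\to Y$, and: (1) $F:\mathbb R\times B_r\to Y$ is of class $C^1$; (2) the mixed partial derivative $\partial_\Omega\partial_fF:\mathbb R\times B_r\to\mathcal L(X,Y)$ exists and is continuous, where $\mathcal L(X,Y)$ is the space of bounded linear operators with the operator norm, $\partial_fF$ is the Fréchet derivative in $f$, and $\partial_\Omega$ is taken in $\mathcal L(X,Y)$. -/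

import Mathlib

open scoped NNReal ComplexConjugate

namespace SQGPatch

noncomputable section

/-! ### Calculus on the unit circle -/

/-- The mean `⨍_𝕋 f(τ) dτ = (1 / 2iπ) ∫_𝕋 f(τ) dτ`, where `dτ` is complex integration over the
positively oriented unit circle, parametrized by `τ = e^{iη}`, `dτ = i e^{iη} dη`. -/
def circleMean (f : Circle → ℂ) : ℂ :=
  (2 * Real.pi * Complex.I)⁻¹ *
    ∫ η in (0 : ℝ)..(2 * Real.pi), f (Circle.exp η) * (Complex.I * (Circle.exp η : ℂ))

/-- The `n`-th Fourier coefficient `⨍_𝕋 f(w) w^{-n-1} dw = (1 / 2π) ∫ f(e^{iη}) e^{-inη} dη`. -/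
def fourierCoef (f : Circle → ℂ) (n : ℤ) : ℂ :=
  circleMean fun w => f w * (w : ℂ) ^ (-(n + 1))

/-- Differentiability at `w` along the circle: `η ↦ f(w e^{iη})` is differentiable at `0`. -/
def DiffAt (f : Circle → ℂ) (w : Circle) : Prop :=
  DifferentiableAt ℝ (fun η : ℝ => f (w * Circle.exp η)) 0

/-- The derivative `f'(w) = df/dw = -i w̄ g'(η)`, where `g(η) = f(e^{iη})` and `w = e^{iη}`. -/
def dw (f : Circle → ℂ) (w : Circle) : ℂ :=
  -Complex.I * conj (w : ℂ) * deriv (fun η : ℝ => f (w * Circle.exp η)) 0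

/-! ### The Hölder space `C^γ(𝕋)` -/

/-- Continuous functions on the circle that are Hölder continuous with exponent `γ`. -/
def holderSubmodule (γ : ℝ≥0) : Submodule ℝ C(Circle, ℂ) where
  carrier := {f | MemHolder γ f}
  zero_mem' := memHolder_zero
  add_mem' := fun hf hg => MemHolder.add hf hg
  smul_mem' := fun _ _ hf => MemHolder.smul hf

/-- The space `C^γ(𝕋)` as a type. It carries the Hölder norm defined below, not the norm inherited
from `C(Circle, ℂ)`. -/
def Holder (γ : ℝ≥0) : Type := holderSubmodule γ

namespace Holder

variable {γ : ℝ≥0}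

instance : AddCommGroup (Holder γ) := inferInstanceAs (AddCommGroup (holderSubmodule γ))
instance : Module ℝ (Holder γ) := inferInstanceAs (Module ℝ (holderSubmodule γ))

/-- The underlying continuous function. -/
def toCM : Holder γ →ₗ[ℝ] C(Circle, ℂ) := (holderSubmodule γ).subtype

instance : CoeFun (Holder γ) (fun _ => Circle → ℂ) := ⟨fun f => toCM f⟩

theorem toCM_injective : Function.Injective (toCM : Holder γ → C(Circle, ℂ)) :=
  Subtype.val_injective

theorem memHolder (f : Holder γ) : MemHolder γ (f : Circle → ℂ) := f.2

/-- `‖f‖_{C^γ} = ‖f‖_{L^∞} + sup_{x ≠ y} |f(x) - f(y)| / |x - y|^γ`. -/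
instance : Norm (Holder γ) := ⟨fun f => ‖toCM f‖ + nnHolderNorm γ (f : Circle → ℂ)⟩

theorem norm_def (f : Holder γ) : ‖f‖ = ‖toCM f‖ + nnHolderNorm γ (f : Circle → ℂ) := rfl

theorem normCore : NormedSpace.Core ℝ (Holder γ) where
  norm_nonneg f := by rw [norm_def]; positivity
  norm_smul c f := by
    have h : nnHolderNorm γ (toCM (c • f)) = ‖c‖₊ * nnHolderNorm γ (toCM f) := by
      rw [map_smul]
      exact (memHolder f).nnHolderNorm_smul c
    rw [norm_def, norm_def, h, map_smul, norm_smul]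
    push_cast
    ring
  norm_triangle f g := by
    have h : nnHolderNorm γ (toCM (f + g)) ≤ nnHolderNorm γ (toCM f) + nnHolderNorm γ (toCM g) := by
      rw [map_add]
      exact (memHolder f).nnHolderNorm_add_le (memHolder g)
    have h' : (nnHolderNorm γ (toCM (f + g)) : ℝ)
        ≤ nnHolderNorm γ (toCM f) + nnHolderNorm γ (toCM g) := by exact_mod_cast h
    have h2 := norm_add_le (toCM f) (toCM g)
    rw [norm_def, norm_def, norm_def]
    rw [← map_add] at h2
    linarith
  norm_eq_zero_iff f := by
    constructor
    · intro h
      rw [norm_def] at h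
      have h1 : ‖toCM f‖ = 0 := le_antisymm
        (by have := (nnHolderNorm γ (toCM f)).coe_nonneg; linarith) (norm_nonneg _)
      apply toCM_injective
      rw [map_zero]
      exact norm_eq_zero.1 h1
    · rintro rfl
      have h : nnHolderNorm γ ((toCM (0 : Holder γ)) : Circle → ℂ) = 0 := by
        rw [map_zero]; exact nnHolderNorm_zero Circle γ
      rw [norm_def, h, map_zero]
      simp

instance : NormedAddCommGroup (Holder γ) := NormedAddCommGroup.ofCore normCore
instance : NormedSpace ℝ (Holder γ) := NormedSpace.ofCore normCore

end Holder

/-! ### The Hölder space `C^{1+γ}(𝕋)` -/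

theorem dw_add {f g : Circle → ℂ} {w : Circle} (hf : DiffAt f w) (hg : DiffAt g w) :
    dw (f + g) w = dw f w + dw g w := by
  unfold dw
  rw [← mul_add]
  congr 1
  exact deriv_add hf hg

theorem dw_smul (c : ℝ) {f : Circle → ℂ} {w : Circle} (hf : DiffAt f w) :
    dw (c • f) w = c • dw f w := by
  unfold dw
  rw [← mul_smul_comm]
  congr 1
  exact deriv_const_smul c hf

/-- Functions of class `C^1` on the circle whose derivative `f' = df/dw` is Hölder continuous with
exponent `γ`. -/
def holderOneSubmodule (γ : ℝ≥0) : Submodule ℝ C(Circle, ℂ) where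
  carrier := {f | (∀ w, DiffAt f w) ∧ Continuous (dw f) ∧ MemHolder γ (dw f)}
  zero_mem' := by
    have h : dw ((0 : C(Circle, ℂ)) : Circle → ℂ) = 0 := by
      funext w; simp [dw]
    refine ⟨fun w => differentiableAt_const (0 : ℂ), ?_, ?_⟩
    · rw [h]; exact continuous_zero
    · rw [h]; exact memHolder_zero
  add_mem' := by
    rintro f g ⟨hf, hf1, hf2⟩ ⟨hg, hg1, hg2⟩
    have h : dw ((f + g : C(Circle, ℂ)) : Circle → ℂ) = dw f + dw g :=
      funext fun w => dw_add (hf w) (hg w)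
    refine ⟨fun w => (hf w).add (hg w), ?_, ?_⟩
    · rw [h]; exact hf1.add hg1
    · rw [h]; exact hf2.add hg2
  smul_mem' := by
    rintro c f ⟨hf, hf1, hf2⟩
    have h : dw ((c • f : C(Circle, ℂ)) : Circle → ℂ) = c • dw f :=
      funext fun w => dw_smul c (hf w)
    refine ⟨fun w => (hf w).const_smul c, ?_, ?_⟩
    · rw [h]; exact hf1.const_smul c
    · rw [h]; exact hf2.smul

/-- The space `C^{1+γ}(𝕋)` as a type. -/
def HolderOne (γ : ℝ≥0) : Type := holderOneSubmodule γ

namespace HolderOne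

variable {γ : ℝ≥0}

instance : AddCommGroup (HolderOne γ) := inferInstanceAs (AddCommGroup (holderOneSubmodule γ))
instance : Module ℝ (HolderOne γ) := inferInstanceAs (Module ℝ (holderOneSubmodule γ))

/-- The underlying continuous function. -/
def toCM : HolderOne γ →ₗ[ℝ] C(Circle, ℂ) := (holderOneSubmodule γ).subtype

instance : CoeFun (HolderOne γ) (fun _ => Circle → ℂ) := ⟨fun f => toCM f⟩

theorem toCM_injective : Function.Injective (toCM : HolderOne γ → C(Circle, ℂ)) :=
  Subtype.val_injective

/-- The derivative `f ↦ f' = df/dw` as a linear map `C^{1+γ}(𝕋) → C^γ(𝕋)`. -/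
def deriv : HolderOne γ →ₗ[ℝ] Holder γ where
  toFun f := ⟨⟨dw f, f.2.2.1⟩, f.2.2.2⟩
  map_add' f g := Subtype.ext (ContinuousMap.ext fun w => dw_add (f.2.1 w) (g.2.1 w))
  map_smul' c f := Subtype.ext (ContinuousMap.ext fun w => dw_smul c (f.2.1 w))

theorem deriv_apply (f : HolderOne γ) (w : Circle) : deriv f w = dw f w := rfl

/-- `‖f‖_{C^{1+γ}} = ‖f‖_{L^∞} + ‖f'‖_{C^γ}`. -/
instance : Norm (HolderOne γ) := ⟨fun f => ‖toCM f‖ + ‖deriv f‖⟩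

theorem norm_def (f : HolderOne γ) : ‖f‖ = ‖toCM f‖ + ‖deriv f‖ := rfl

theorem normCore : NormedSpace.Core ℝ (HolderOne γ) where
  norm_nonneg f := by rw [norm_def]; positivity
  norm_smul c f := by
    rw [norm_def, norm_def, map_smul, map_smul, norm_smul, norm_smul]; ring
  norm_triangle f g := by
    rw [norm_def, norm_def, norm_def, map_add, map_add]
    have h1 := norm_add_le (toCM f) (toCM g)
    have h2 := norm_add_le (deriv f) (deriv g)
    linarith
  norm_eq_zero_iff f := by
    constructor
    · intro h
      rw [norm_def] at h
      have h1 : ‖toCM f‖ = 0 := le_antisymm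
        (by have := norm_nonneg (deriv f); linarith) (norm_nonneg _)
      apply toCM_injective
      rw [map_zero]
      exact norm_eq_zero.1 h1
    · rintro rfl
      rw [norm_def, map_zero, map_zero]
      simp

instance : NormedAddCommGroup (HolderOne γ) := NormedAddCommGroup.ofCore normCore
instance : NormedSpace ℝ (HolderOne γ) := NormedSpace.ofCore normCore

end HolderOne

/-! ### The spaces `X` and `Y` -/

theorem integrable_fourierCoef (f : C(Circle, ℂ)) (n : ℤ) :
    IntervalIntegrable (fun η : ℝ => f (Circle.exp η) * (Circle.exp η : ℂ) ^ (-(n + 1)) *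
      (Complex.I * (Circle.exp η : ℂ))) MeasureTheory.volume 0 (2 * Real.pi) := by
  apply Continuous.intervalIntegrable
  have h : Continuous fun η : ℝ => (Circle.exp η : ℂ) :=
    continuous_induced_dom.comp Circle.exp.continuous
  exact ((f.continuous.comp Circle.exp.continuous).mul
    (h.zpow₀ _ fun η => Or.inl (Circle.coe_ne_zero _))).mul (continuous_const.mul h)

theorem fourierCoef_zero (n : ℤ) : fourierCoef ((0 : C(Circle, ℂ)) : Circle → ℂ) n = 0 := by
  simp [fourierCoef, circleMean]

theorem fourierCoef_add (f g : C(Circle, ℂ)) (n : ℤ) :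
    fourierCoef ((f + g : C(Circle, ℂ)) : Circle → ℂ) n = fourierCoef f n + fourierCoef g n := by
  unfold fourierCoef circleMean
  rw [← mul_add, ← intervalIntegral.integral_add (integrable_fourierCoef f n)
    (integrable_fourierCoef g n)]
  congr 2
  funext η
  simp only [ContinuousMap.add_apply]
  ring

theorem fourierCoef_smul (c : ℝ) (f : C(Circle, ℂ)) (n : ℤ) :
    fourierCoef ((c • f : C(Circle, ℂ)) : Circle → ℂ) n = c * fourierCoef f n := by
  unfold fourierCoef circleMean
  rw [mul_left_comm, ← intervalIntegral.integral_const_mul (c : ℂ)]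
  congr 2
  funext η
  simp only [ContinuousMap.smul_apply, Complex.real_smul]
  ring

/-- The Hölder exponent `1 - α`. -/
def expo (α : ℝ) : ℝ≥0 := (1 - α).toNNReal

/-- `X = {f ∈ C^{2-α}(𝕋) : f(w) = ∑_{n ≥ 0} b_n w̄^n, b_n ∈ ℝ}`: all Fourier coefficients of `f`
are real, and those of positive index vanish. The norm is the one of `C^{2-α}(𝕋)`. -/
def X (α : ℝ) : Submodule ℝ (HolderOne (expo α)) where
  carrier := {f | ∀ n : ℤ, (fourierCoef f n).im = 0 ∧ (0 < n → fourierCoef f n = 0)}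
  zero_mem' := by
    intro n
    rw [map_zero, fourierCoef_zero]
    simp
  add_mem' := by
    intro f g hf hg n
    rw [map_add, fourierCoef_add]
    refine ⟨by simp [(hf n).1, (hg n).1], fun hn => by rw [(hf n).2 hn, (hg n).2 hn, add_zero]⟩
  smul_mem' := by
    intro c f hf n
    rw [map_smul, fourierCoef_smul]
    refine ⟨by simp [(hf n).1], fun hn => by rw [(hf n).2 hn, mul_zero]⟩

/-- `Y = {g ∈ C^{1-α}(𝕋) : g(w) = i ∑_{n ≥ 1} g_n (w^n - w̄^n), g_n ∈ ℝ}`: the Fourier coefficients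
of `g` are purely imaginary and odd in the index. The norm is the one of `C^{1-α}(𝕋)`. -/
def Y (α : ℝ) : Submodule ℝ (Holder (expo α)) where
  carrier := {g | ∀ n : ℤ, (fourierCoef g n).re = 0 ∧ fourierCoef g (-n) = -fourierCoef g n}
  zero_mem' := by
    intro n
    rw [map_zero, fourierCoef_zero, fourierCoef_zero]
    simp
  add_mem' := by
    intro f g hf hg n
    rw [map_add, fourierCoef_add, fourierCoef_add]
    refine ⟨by simp [(hf n).1, (hg n).1], by rw [(hf n).2, (hg n).2]; ring⟩
  smul_mem' := by
    intro c f hf n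
    rw [map_smul, fourierCoef_smul, fourierCoef_smul]
    refine ⟨by simp [(hf n).1], by rw [(hf n).2]; ring⟩

/-! ### The functional -/

/-- `C_α = Γ(α/2) / (2^{1-α} Γ((2-α)/2))`. -/
def sqgConst (α : ℝ) : ℝ :=
  Real.Gamma (α / 2) / ((2 : ℝ) ^ (1 - α) * Real.Gamma ((2 - α) / 2))

/-- The integrand `φ'(τ) / |φ(w) - φ(τ)|^α`. -/
def kernel (α : ℝ) (φ : Circle → ℂ) (w τ : Circle) : ℂ :=
  dw φ τ / ((‖φ w - φ τ‖ ^ α : ℝ) : ℂ)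

/-- `G(Ω, φ)(w) = Im {(Ω φ(w) - C_α ⨍_𝕋 φ'(τ) / |φ(w) - φ(τ)|^α dτ) w̄ \overline{φ'(w)}}`. -/
def G (α Ω : ℝ) (φ : Circle → ℂ) (w : Circle) : ℝ :=
  (((Ω : ℂ) * φ w - (sqgConst α : ℂ) * circleMean (kernel α φ w)) *
    conj (w : ℂ) * conj (dw φ w)).im

/-- The map `φ(w) = w + f(w)`. -/
def shift (f : Circle → ℂ) (w : Circle) : ℂ := (w : ℂ) + f w

end

end SQGPatch

/-!
The singular integral is turned into an absolutely convergent integral of smooth operations. Write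
`τ = w e^{is}` with `s ∈ (0, 2π)` and factor
`φ(w) - φ(w e^{is}) = (1 - e^{is}) q(w, s)`, where `q` is the difference quotient of `φ`. Up to
the normalization of the circle mean, the potential at `w` is
`∫_0^{2π} |1 - e^{is}|^{-α} · w e^{is} φ'(w e^{is}) · |q(w, s)|^{-α} ds`.
The weight `|1 - e^{is}|^{-α}` is integrable and does not involve `φ`, and both
`φ ↦ w e^{is} φ'(w e^{is})` and `φ ↦ q` are bounded linear operators from `C^{1+γ}(𝕋)` to
`C^γ(𝕋, V)`, `γ = 1 - α`, `V = C_b(0, 2π)`: a difference quotient is an average of rotations of the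
derivative, so no regularity is lost, uniformly in `s` (`HolderOne.norm_increment_sub_le`). Working
with functions of `w` whose values are bounded continuous functions of `s` replaces a Bochner
integral in `C^γ(𝕋)`, which is not available because rotations act discontinuously on that
nonseparable space, by the composition with one functional on `V` (`weightIntegral`).

The only nonlinear ingredient is `q ↦ |q|^{-α}`. The space `C^γ(𝕋, V)` is a commutative Banach
algebra (`HolderAlg`), and near `q₀` bounded away from zero the operator is a binomial series in
this algebra, hence smooth (`exists_contDiffAt_norm_rpow`). For `φ = Id + f` with `‖f‖ < 1` the
quotient does stay away from zero, because the chordal Lipschitz constant of `f` is at most the full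
norm `‖f‖` (`HolderOne.norm_sub_mul_le`), so that `|q| ≥ 1 - ‖f‖`.

Functions `f ∈ X` satisfy `f(w̄) = \overline{f(w)}` by uniqueness of Fourier coefficients
(`X_apply_inv`), which makes `G(Ω, Id + f)` odd under `w ↦ w̄` (`G_apply_inv`); real odd functions
are in `Y`. So nothing is lost by taking the odd part of the imaginary part, and this is a bounded
linear map into `Y` (`oddImL`), which carries smoothness in `C^γ(𝕋)` over to `Y`. Finally
`F(Ω, f)` is affine in `Ω`, with coefficient `rotationPart f`, whose derivative in `f` is the mixed
derivative.
-/

namespace SQGPatch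

noncomputable section

/-! ### The Banach algebra of Hölder maps into a normed algebra -/

section Bounds

variable {V : Type*} [NormedAddCommGroup V] {γ : ℝ≥0} {f : Circle → V} {C : ℝ}

theorem holderWith_of_norm_le (hC : 0 ≤ C)
    (h : ∀ x y, ‖f x - f y‖ ≤ C * dist x y ^ (γ : ℝ)) : HolderWith C.toNNReal γ f := by
  intro x y
  rw [edist_dist, edist_dist, dist_eq_norm, ENNReal.ofReal_rpow_of_nonneg dist_nonneg γ.coe_nonneg]
  change _ ≤ ENNReal.ofReal C * _
  rw [← ENNReal.ofReal_mul hC]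
  exact ENNReal.ofReal_le_ofReal (h x y)

theorem memHolder_of_norm_le (hC : 0 ≤ C)
    (h : ∀ x y, ‖f x - f y‖ ≤ C * dist x y ^ (γ : ℝ)) : MemHolder γ f :=
  (holderWith_of_norm_le hC h).memHolder

theorem nnHolderNorm_le_of_norm_le (hC : 0 ≤ C)
    (h : ∀ x y, ‖f x - f y‖ ≤ C * dist x y ^ (γ : ℝ)) : (nnHolderNorm γ f : ℝ) ≤ C := by
  have h1 : nnHolderNorm γ f ≤ C.toNNReal := (holderWith_of_norm_le hC h).nnholderNorm_le
  simpa [Real.coe_toNNReal _ hC] using NNReal.coe_le_coe.2 h1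

theorem norm_sub_le_of_memHolder (h : MemHolder γ f) (x y : Circle) :
    ‖f x - f y‖ ≤ nnHolderNorm γ f * dist x y ^ (γ : ℝ) := by
  rw [← dist_eq_norm]
  exact h.holderWith.dist_le x y

end Bounds

section Algebra

theorem norm_mul_sub_mul_le {γ : ℝ≥0} {V : Type*} [NormedCommRing V]
    {f g : C(Circle, V)} (hf : MemHolder γ f) (hg : MemHolder γ g)
    (x y : Circle) :
    ‖(f * g) x - (f * g) y‖ ≤ (‖f‖ * nnHolderNorm γ g + nnHolderNorm γ f * ‖g‖)
      * dist x y ^ (γ : ℝ) := by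
  have h : (f * g) x - (f * g) y = f x * (g x - g y) + (f x - f y) * g y := by
    simp only [ContinuousMap.mul_apply]; ring
  rw [h, add_mul]
  have hd : 0 ≤ dist x y ^ (γ : ℝ) := by positivity
  refine (norm_add_le _ _).trans (add_le_add ?_ ?_)
  · refine (norm_mul_le _ _).trans ?_
    rw [mul_assoc]
    exact mul_le_mul (f.norm_coe_le_norm x) (norm_sub_le_of_memHolder hg x y) (norm_nonneg _)
      (norm_nonneg _)
  · refine (norm_mul_le _ _).trans ?_
    rw [mul_right_comm]
    exact mul_le_mul (norm_sub_le_of_memHolder hf x y) (g.norm_coe_le_norm y) (norm_nonneg _)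
      (by positivity)

variable (γ : ℝ≥0) (V : Type*) [NormedCommRing V] [NormedAlgebra ℝ V]

/-- The subalgebra of Hölder continuous functions with exponent `γ` in `C(𝕋, V)`, where `V` is a
normed algebra. -/
def holderSubalgebra : Subalgebra ℝ C(Circle, V) where
  carrier := {f | MemHolder γ f}
  mul_mem' := fun hf hg => memHolder_of_norm_le (by positivity) (norm_mul_sub_mul_le hf hg)
  add_mem' := fun hf hg => MemHolder.add hf hg
  algebraMap_mem' := fun _ => memHolder_const

/-- The algebra `C^γ(𝕋, V)` of `γ`-Hölder functions on the circle with values in a normed algebra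
`V`. It carries the Hölder norm `‖f‖_{L^∞} + [f]_γ`, which is submultiplicative. -/
def HolderAlg : Type _ := holderSubalgebra γ V

namespace HolderAlg

instance : CommRing (HolderAlg γ V) := inferInstanceAs (CommRing (holderSubalgebra γ V))
instance : Algebra ℝ (HolderAlg γ V) := inferInstanceAs (Algebra ℝ (holderSubalgebra γ V))

variable {γ V}

/-- The underlying continuous function. -/
def toCM : HolderAlg γ V →ₐ[ℝ] C(Circle, V) := (holderSubalgebra γ V).val

instance : CoeFun (HolderAlg γ V) (fun _ => Circle → V) := ⟨fun f => toCM f⟩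

theorem toCM_injective : Function.Injective (toCM : HolderAlg γ V → C(Circle, V)) :=
  Subtype.val_injective

@[ext] theorem ext {f g : HolderAlg γ V} (h : ∀ w, f w = g w) : f = g :=
  toCM_injective (ContinuousMap.ext h)

theorem memHolder (f : HolderAlg γ V) : MemHolder γ (f : Circle → V) := f.2

@[simp] theorem add_apply (f g : HolderAlg γ V) (w : Circle) : (f + g) w = f w + g w := by
  rw [map_add]; rfl

@[simp] theorem sub_apply (f g : HolderAlg γ V) (w : Circle) : (f - g) w = f w - g w := by
  rw [map_sub]; rfl

@[simp] theorem mul_apply (f g : HolderAlg γ V) (w : Circle) : (f * g) w = f w * g w := by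
  rw [map_mul]; rfl

@[simp] theorem smul_apply (c : ℝ) (f : HolderAlg γ V) (w : Circle) : (c • f) w = c • f w := by
  rw [map_smul]; rfl

instance : Norm (HolderAlg γ V) := ⟨fun f => ‖toCM f‖ + nnHolderNorm γ (f : Circle → V)⟩

theorem norm_def (f : HolderAlg γ V) : ‖f‖ = ‖toCM f‖ + nnHolderNorm γ (f : Circle → V) := rfl

theorem normCore : NormedSpace.Core ℝ (HolderAlg γ V) where
  norm_nonneg f := by rw [norm_def]; positivity
  norm_smul c f := by
    have h : nnHolderNorm γ (toCM (c • f)) = ‖c‖₊ * nnHolderNorm γ (toCM f) := by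
      rw [map_smul]
      exact (memHolder f).nnHolderNorm_smul c
    rw [norm_def, norm_def, h, map_smul, norm_smul]
    push_cast
    ring
  norm_triangle f g := by
    have h : nnHolderNorm γ (toCM (f + g)) ≤ nnHolderNorm γ (toCM f) + nnHolderNorm γ (toCM g) := by
      rw [map_add]
      exact (memHolder f).nnHolderNorm_add_le (memHolder g)
    have h' : (nnHolderNorm γ (toCM (f + g)) : ℝ)
        ≤ nnHolderNorm γ (toCM f) + nnHolderNorm γ (toCM g) := by exact_mod_cast h
    have h2 := norm_add_le (toCM f) (toCM g)
    rw [norm_def, norm_def, norm_def]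
    rw [← map_add] at h2
    linarith
  norm_eq_zero_iff f := by
    constructor
    · intro h
      rw [norm_def] at h
      have h1 : ‖toCM f‖ = 0 := le_antisymm
        (by have := (nnHolderNorm γ (toCM f)).coe_nonneg; linarith) (norm_nonneg _)
      apply toCM_injective
      rw [map_zero]
      exact norm_eq_zero.1 h1
    · rintro rfl
      have h : nnHolderNorm γ ((toCM (0 : HolderAlg γ V)) : Circle → V) = 0 := by
        rw [map_zero]; exact nnHolderNorm_zero Circle γ
      rw [norm_def, h, map_zero]
      simp

instance : NormedAddCommGroup (HolderAlg γ V) := NormedAddCommGroup.ofCore normCore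
instance : NormedSpace ℝ (HolderAlg γ V) := NormedSpace.ofCore normCore

theorem norm_mul_le' (f g : HolderAlg γ V) : ‖f * g‖ ≤ ‖f‖ * ‖g‖ := by
  have h1 : (nnHolderNorm γ (toCM (f * g)) : ℝ) ≤
      ‖toCM f‖ * nnHolderNorm γ (toCM g) + nnHolderNorm γ (toCM f) * ‖toCM g‖ := by
    rw [map_mul]
    exact nnHolderNorm_le_of_norm_le (by positivity) (norm_mul_sub_mul_le f.memHolder g.memHolder)
  have h2 : ‖toCM (f * g)‖ ≤ ‖toCM f‖ * ‖toCM g‖ := by rw [map_mul]; exact norm_mul_le _ _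
  have h3 : (0 : ℝ) ≤ nnHolderNorm γ (toCM f) * nnHolderNorm γ (toCM g) := by positivity
  rw [norm_def, norm_def, norm_def]
  nlinarith

instance : NormedCommRing (HolderAlg γ V) where
  __ := (inferInstance : NormedAddCommGroup (HolderAlg γ V))
  __ := (inferInstance : CommRing (HolderAlg γ V))
  norm_mul_le := norm_mul_le'

instance : NormedAlgebra ℝ (HolderAlg γ V) where
  norm_smul_le c f := (norm_smul c f).le

theorem norm_apply_le (f : HolderAlg γ V) (w : Circle) : ‖f w‖ ≤ ‖f‖ := by
  have h := (toCM f).norm_coe_le_norm w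
  have h2 := (nnHolderNorm γ (toCM f)).coe_nonneg
  rw [norm_def]; linarith

theorem norm_apply_sub_le (f : HolderAlg γ V) (x y : Circle) :
    ‖f x - f y‖ ≤ ‖f‖ * dist x y ^ (γ : ℝ) := by
  refine (norm_sub_le_of_memHolder f.memHolder x y).trans ?_
  have h := norm_nonneg (toCM f)
  gcongr
  rw [norm_def]; linarith

theorem norm_le {f : HolderAlg γ V} {A B : ℝ} (hA : 0 ≤ A) (hB : 0 ≤ B) (h1 : ∀ w, ‖f w‖ ≤ A)
    (h2 : ∀ x y, ‖f x - f y‖ ≤ B * dist x y ^ (γ : ℝ)) : ‖f‖ ≤ A + B :=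
  add_le_add ((ContinuousMap.norm_le _ hA).2 h1) (nnHolderNorm_le_of_norm_le hB h2)

/-- A function with a Hölder bound, as an element of `C^γ(𝕋, V)`. -/
def mk (hγ : 0 < γ) (f : Circle → V) (B : ℝ) (hB : 0 ≤ B)
    (h : ∀ x y, ‖f x - f y‖ ≤ B * dist x y ^ (γ : ℝ)) : HolderAlg γ V :=
  ⟨⟨f, (holderWith_of_norm_le hB h).continuous hγ⟩, memHolder_of_norm_le hB h⟩

/-- Evaluation at a point of the circle. -/
def eval (w : Circle) : HolderAlg γ V →L[ℝ] V :=
  LinearMap.mkContinuous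
    { toFun := fun f => f w
      map_add' := fun f g => add_apply f g w
      map_smul' := fun c f => smul_apply c f w } 1 fun f => by
    simpa using norm_apply_le f w

instance [CompleteSpace V] : CompleteSpace (HolderAlg γ V) := by
  refine Metric.complete_of_cauchySeq_tendsto fun u hu => ?_
  have hc : CauchySeq fun n => toCM (u n) := by
    rw [Metric.cauchySeq_iff'] at hu ⊢
    intro ε hε
    obtain ⟨N, hN⟩ := hu ε hε
    refine ⟨N, fun n hn => lt_of_le_of_lt ?_ (hN n hn)⟩
    rw [dist_eq_norm, dist_eq_norm, ← map_sub, norm_def]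
    exact le_add_of_nonneg_right (by positivity)
  obtain ⟨g, hg⟩ := cauchySeq_tendsto_of_complete hc
  have hgw : ∀ w, Filter.Tendsto (fun n => u n w) Filter.atTop (nhds (g w)) := fun w =>
    ((continuous_eval_const w).tendsto g).comp hg
  -- the Hölder bound of `u n - u m` passes to the limit `m → ∞`
  have key : ∀ ε > 0, ∃ N, ∀ n ≥ N, (∀ w, ‖u n w - g w‖ ≤ ε) ∧
      ∀ x y, ‖(u n x - g x) - (u n y - g y)‖ ≤ ε * dist x y ^ (γ : ℝ) := by
    intro ε hε
    obtain ⟨N, hN⟩ := Metric.cauchySeq_iff.1 hu ε hε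
    refine ⟨N, fun n hn => ⟨fun w => ?_, fun x y => ?_⟩⟩
    · refine le_of_tendsto ((tendsto_const_nhds.sub (hgw w)).norm) ?_
      filter_upwards [Filter.eventually_ge_atTop N] with m hm
      rw [← sub_apply]
      refine (norm_apply_le _ w).trans ?_
      rw [← dist_eq_norm]
      exact (hN n hn m hm).le
    · refine le_of_tendsto
        (((tendsto_const_nhds.sub (hgw x)).sub (tendsto_const_nhds.sub (hgw y))).norm) ?_
      filter_upwards [Filter.eventually_ge_atTop N] with m hm
      rw [← sub_apply, ← sub_apply]
      refine (norm_apply_sub_le _ x y).trans ?_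
      rw [← dist_eq_norm]
      gcongr
      exact (hN n hn m hm).le
  have hmem : MemHolder γ g := by
    obtain ⟨N, hN⟩ := key 1 one_pos
    refine memHolder_of_norm_le (C := ‖u N‖ + 1) (by positivity) fun x y => ?_
    have h1 := (hN N le_rfl).2 x y
    have h2 := norm_apply_sub_le (u N) x y
    have h3 : g x - g y = (u N x - u N y) - ((u N x - g x) - (u N y - g y)) := by abel
    rw [h3, add_mul]
    exact (norm_sub_le _ _).trans (add_le_add h2 h1)
  let G : HolderAlg γ V := ⟨g, hmem⟩
  refine ⟨G, Metric.tendsto_atTop.2 fun ε hε => ?_⟩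
  obtain ⟨N, hN⟩ := key (ε / 3) (by positivity)
  refine ⟨N, fun n hn => ?_⟩
  rw [dist_eq_norm]
  refine lt_of_le_of_lt (norm_le (A := ε / 3) (B := ε / 3) (by positivity) (by positivity)
    (fun w => ?_) fun x y => ?_) (by linarith)
  · rw [sub_apply]; exact (hN n hn).1 w
  · rw [sub_apply, sub_apply]; exact (hN n hn).2 x y

/-- The map `C^γ(𝕋, V) → C^γ(𝕋, W)` given by applying a continuous linear map `V → W` pointwise. -/
def mapL {W : Type*} [NormedCommRing W] [NormedAlgebra ℝ W] (T : V →L[ℝ] W) :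
    HolderAlg γ V →L[ℝ] HolderAlg γ W :=
  have h (f : HolderAlg γ V) (x y : Circle) :
      ‖T (f x) - T (f y)‖ ≤ ‖T‖ * ‖f‖ * dist x y ^ (γ : ℝ) := by
    rw [← map_sub, mul_assoc]
    exact (T.le_opNorm _).trans (by gcongr; exact norm_apply_sub_le f x y)
  LinearMap.mkContinuous
    { toFun := fun f => ⟨⟨fun w => T (f w), T.continuous.comp (toCM f).continuous⟩,
        memHolder_of_norm_le (by positivity) (h f)⟩
      map_add' := fun f g => ext fun w => by
        change T ((f + g) w) = T (f w) + T (g w)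
        rw [add_apply, map_add]
      map_smul' := fun c f => ext fun w => by
        change T ((c • f) w) = c • T (f w)
        rw [smul_apply, map_smul] } (‖T‖ + ‖T‖) fun f => by
    rw [add_mul]
    refine norm_le (by positivity) (by positivity) (fun w => ?_) (h f)
    exact (T.le_opNorm _).trans (by gcongr; exact norm_apply_le f w)

@[simp] theorem mapL_apply {W : Type*} [NormedCommRing W] [NormedAlgebra ℝ W] (T : V →L[ℝ] W)
    (f : HolderAlg γ V) (w : Circle) : mapL T f w = T (f w) := rfl

end HolderAlg

end Algebra

open BoundedContinuousFunction MeasureTheory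

/-! ### Real powers of the modulus -/

theorem one_le_radius_binomialSeries {𝔸 : Type*} [NormedRing 𝔸] [NormedAlgebra ℝ 𝔸] (a : ℝ) :
    1 ≤ (binomialSeries 𝔸 a).radius := by
  refine ENNReal.le_of_forall_nnreal_lt fun r hr => ?_
  have h1 : (r : ENNReal) < (binomialSeries ℝ a).radius :=
    hr.trans_le binomialSeries_radius_ge_one
  obtain ⟨C, hC, h⟩ := (binomialSeries ℝ a).norm_mul_pow_le_of_lt_radius h1
  refine (binomialSeries 𝔸 a).le_radius_of_eventually_le C ?_
  filter_upwards [Filter.eventually_gt_atTop 0] with n hn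
  refine le_trans ?_ (h n)
  gcongr
  have h2 : ‖binomialSeries ℝ a n‖ = ‖Ring.choose a n‖ :=
    FormalMultilinearSeries.ofScalars_norm ℝ (fun k => Ring.choose a k) n
  rw [h2]
  exact FormalMultilinearSeries.ofScalars_norm_le 𝔸 (fun k => Ring.choose a k) n hn

section Superposition

variable {γ : ℝ≥0} {S : Type*} [TopologicalSpace S]

/-- Evaluation of a Hölder family at a point of the circle and a parameter. -/
def evalAt (w : Circle) (s : S) : HolderAlg γ (S →ᵇ ℂ) →L[ℝ] ℂ :=
  (BoundedContinuousFunction.evalCLM ℝ s).comp (HolderAlg.eval w)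

theorem evalAt_apply (w : Circle) (s : S) (f : HolderAlg γ (S →ᵇ ℂ)) : evalAt w s f = f w s := rfl

/-- The binomial series in the algebra `C^γ(𝕋, C_b(S))` computes `(1 + x)^a` pointwise. -/
theorem binomialSeries_sum_apply (a : ℝ) {x : HolderAlg γ (S →ᵇ ℂ)} (hx : ‖x‖ < 1) {w : Circle}
    {s : S} {y : ℝ} (hy : x w s = y) :
    (binomialSeries (HolderAlg γ (S →ᵇ ℂ)) a).sum x w s = (((1 + y) ^ a : ℝ) : ℂ) := by
  have hx' : x ∈ Metric.eball (0 : HolderAlg γ (S →ᵇ ℂ))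
      (binomialSeries (HolderAlg γ (S →ᵇ ℂ)) a).radius := by
    refine Metric.eball_subset_eball (one_le_radius_binomialSeries a) ?_
    rw [Metric.mem_eball, edist_zero_right, ← ofReal_norm]
    exact ENNReal.ofReal_lt_one.2 hx
  have h1 := ((binomialSeries (HolderAlg γ (S →ᵇ ℂ)) a).hasSum hx').mapL (evalAt w s)
  have hy1 : |y| < 1 := by
    have h := (x w).norm_coe_le_norm s
    rw [hy, Complex.norm_real, Real.norm_eq_abs] at h
    exact (h.trans (HolderAlg.norm_apply_le x w)).trans_lt hx
  have h2 := (Real.one_add_rpow_hasFPowerSeriesOnBall_zero (a := a)).hasSum (y := y) (by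
    rw [Metric.mem_eball, edist_zero_right, ← ofReal_norm]
    exact ENNReal.ofReal_lt_one.2 hy1)
  rw [zero_add] at h2
  have h3 := h2.mapL Complex.ofRealCLM
  have h4 : ∀ n, (evalAt w s) (binomialSeries (HolderAlg γ (S →ᵇ ℂ)) a n fun _ => x) =
      Complex.ofRealCLM (binomialSeries ℝ a n fun _ => y) := by
    intro n
    rw [binomialSeries_apply, binomialSeries_apply, map_smul, map_smul]
    congr 1
    simp only [List.ofFn_const, List.prod_replicate, Complex.ofRealCLM_apply, Complex.ofReal_pow]
    rw [← hy]
    induction n with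
    | zero => rfl
    | succ n ih =>
      rw [pow_succ, pow_succ, ← ih]
      simp only [evalAt_apply, HolderAlg.mul_apply, BoundedContinuousFunction.mul_apply]
  simp only [h4] at h1
  exact h1.unique h3

theorem abs_rpow_sub_rpow_le {a δ x y : ℝ} (ha : a ≤ 0) (hδ : 0 < δ) (hx : δ ≤ x) (hy : δ ≤ y) :
    |x ^ a - y ^ a| ≤ -a * δ ^ (a - 1) * |x - y| := by
  have h := (convex_Ici δ).norm_image_sub_le_of_norm_deriv_le (f := fun t : ℝ => t ^ a)
    (C := -a * δ ^ (a - 1)) (fun t ht => ?_) (fun t ht => ?_) (Set.mem_Ici.2 hy) (Set.mem_Ici.2 hx)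
  · simpa [Real.norm_eq_abs] using h
  · exact Real.differentiableAt_rpow_const_of_ne a (hδ.trans_le ht).ne'
  · have ht0 : 0 < t := hδ.trans_le ht
    rw [Real.deriv_rpow_const, norm_mul, Real.norm_eq_abs, abs_of_nonpos ha,
      Real.norm_of_nonneg (by positivity)]
    exact mul_le_mul_of_nonneg_left (Real.rpow_le_rpow_of_nonpos hδ ht (by linarith)) (by linarith)

/-- If `q` is bounded away from zero, nonpositive powers of `|q|` are again Hölder families. -/
theorem exists_norm_rpow (hγ : 0 < γ) {a : ℝ} (ha : a ≤ 0) (q : HolderAlg γ (S →ᵇ ℂ)) {δ : ℝ}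
    (hδ : 0 < δ) (hq : ∀ w s, δ ≤ ‖q w s‖) :
    ∃ p : HolderAlg γ (S →ᵇ ℂ), ∀ w s, p w s = ((‖q w s‖ ^ a : ℝ) : ℂ) := by
  have hb : ∀ w s, ‖((‖q w s‖ ^ a : ℝ) : ℂ)‖ ≤ δ ^ a := fun w s => by
    rw [Complex.norm_real, Real.norm_of_nonneg (by positivity)]
    exact Real.rpow_le_rpow_of_nonpos hδ (hq w s) ha
  have hc : ∀ w, Continuous fun s => ((‖q w s‖ ^ a : ℝ) : ℂ) := fun w =>
    Complex.continuous_ofReal.comp ((q w).continuous.norm.rpow_const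
      fun s => Or.inl (hδ.trans_le (hq w s)).ne')
  have ha' : 0 ≤ -a := by linarith
  let v : Circle → (S →ᵇ ℂ) := fun w => ofNormedAddCommGroup _ (hc w) _ (hb w)
  refine ⟨HolderAlg.mk hγ v (-a * δ ^ (a - 1) * ‖q‖) (by positivity) fun x y => ?_, fun w s => rfl⟩
  refine (BoundedContinuousFunction.norm_le (by positivity)).2 fun s => ?_
  change ‖((‖q x s‖ ^ a : ℝ) : ℂ) - ((‖q y s‖ ^ a : ℝ) : ℂ)‖ ≤ _
  rw [← Complex.ofReal_sub, Complex.norm_real, Real.norm_eq_abs]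
  refine (abs_rpow_sub_rpow_le ha hδ (hq x s) (hq y s)).trans ?_
  have hK : 0 ≤ -a * δ ^ (a - 1) := by positivity
  rw [mul_assoc (-a * δ ^ (a - 1))]
  refine mul_le_mul_of_nonneg_left ?_ hK
  refine (abs_norm_sub_norm_le _ _).trans ?_
  rw [← BoundedContinuousFunction.sub_apply]
  exact ((q x - q y).norm_coe_le_norm s).trans (q.norm_apply_sub_le x y)

/-- Pointwise complex conjugation of Hölder families. -/
def conjL : HolderAlg γ (S →ᵇ ℂ) →L[ℝ] HolderAlg γ (S →ᵇ ℂ) :=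
  HolderAlg.mapL ((starL' ℝ : (S →ᵇ ℂ) ≃L[ℝ] (S →ᵇ ℂ)) : (S →ᵇ ℂ) →L[ℝ] (S →ᵇ ℂ))

theorem conjL_apply (q : HolderAlg γ (S →ᵇ ℂ)) (w : Circle) (s : S) :
    conjL q w s = conj (q w s) := rfl

/-- The superposition operator `q ↦ |q|^a` is smooth near every `q₀` bounded away from zero: with
`u = |q|²` and `u₀ = |q₀|²` one has `|q|^a = |q₀|^a (1 + (u - u₀) / u₀)^{a/2}`, and the last factor
is a binomial series in the Banach algebra `C^γ(𝕋, C_b(S))`. -/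
theorem exists_contDiffAt_norm_rpow (hγ : 0 < γ) {a : ℝ} (ha : a ≤ 0)
    (q₀ : HolderAlg γ (S →ᵇ ℂ)) {δ : ℝ} (hδ : 0 < δ) (hq : ∀ w s, δ ≤ ‖q₀ w s‖)
    (n : WithTop ℕ∞) :
    ∃ N : HolderAlg γ (S →ᵇ ℂ) → HolderAlg γ (S →ᵇ ℂ), ContDiffAt ℝ n N q₀ ∧
      ∀ᶠ q in nhds q₀, ∀ w s, N q w s = ((‖q w s‖ ^ a : ℝ) : ℂ) := by
  obtain ⟨m, hm⟩ := exists_norm_rpow hγ ha q₀ hδ hq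
  obtain ⟨i, hi⟩ := exists_norm_rpow hγ (by norm_num : (-2 : ℝ) ≤ 0) q₀ hδ hq
  let Z : HolderAlg γ (S →ᵇ ℂ) → HolderAlg γ (S →ᵇ ℂ) :=
    fun q => (q * conjL q - q₀ * conjL q₀) * i
  have hZ : ContDiff ℝ n Z :=
    ((contDiff_id.mul conjL.contDiff).sub contDiff_const).mul contDiff_const
  have hZ0 : Z q₀ = 0 := by simp only [Z, sub_self, zero_mul]
  have hZs : ∀ q w s, Z q w s = ((‖q w s‖ ^ 2 / ‖q₀ w s‖ ^ 2 - 1 : ℝ) : ℂ) := by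
    intro q w s
    have h0 : ‖q₀ w s‖ ≠ 0 := (hδ.trans_le (hq w s)).ne'
    simp only [Z, HolderAlg.mul_apply, HolderAlg.sub_apply, BoundedContinuousFunction.mul_apply,
      BoundedContinuousFunction.sub_apply, conjL_apply, hi, Complex.mul_conj,
      Complex.normSq_eq_norm_sq]
    rw [Real.rpow_neg (norm_nonneg _), Real.rpow_two]
    norm_cast
    field_simp
  have hP : ContDiffAt ℝ n (binomialSeries (HolderAlg γ (S →ᵇ ℂ)) (a / 2)).sum (Z q₀) := by
    rw [hZ0]
    exact ((binomialSeries (HolderAlg γ (S →ᵇ ℂ)) (a / 2)).hasFPowerSeriesOnBall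
      (one_pos.trans_le (one_le_radius_binomialSeries _))).analyticAt.contDiffAt
  refine ⟨fun q => m * (binomialSeries (HolderAlg γ (S →ᵇ ℂ)) (a / 2)).sum (Z q),
    contDiffAt_const.mul (hP.comp q₀ hZ.contDiffAt), ?_⟩
  have hev : ∀ᶠ q in nhds q₀, ‖Z q‖ < 1 := by
    have h := hZ.continuous.norm.tendsto q₀
    rw [hZ0, norm_zero] at h
    exact h.eventually_lt_const one_pos
  filter_upwards [hev] with q hlt w s
  have h0 : 0 < ‖q₀ w s‖ := hδ.trans_le (hq w s)
  rw [HolderAlg.mul_apply, BoundedContinuousFunction.mul_apply, hm,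
    binomialSeries_sum_apply (a / 2) hlt (hZs q w s), ← Complex.ofReal_mul]
  congr 1
  rw [add_sub_cancel, Real.div_rpow (by positivity) (by positivity), ← Real.rpow_natCast_mul
    (norm_nonneg _), ← Real.rpow_natCast_mul (norm_nonneg _)]
  rw [show ((2 : ℕ) : ℝ) * (a / 2) = a by push_cast; ring]
  field_simp

end Superposition

/-! ### Increments of differentiable functions on the circle -/

theorem circle_dist_eq (x y : Circle) : dist x y = ‖(x : ℂ) - y‖ := by
  rw [← dist_eq_norm]; rfl

theorem circle_dist_mul_right (x y w : Circle) : dist (x * w) (y * w) = dist x y := by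
  rw [circle_dist_eq, circle_dist_eq, Circle.coe_mul, Circle.coe_mul, ← sub_mul, norm_mul,
    Circle.norm_coe, mul_one]

theorem circle_dist_self_mul (w z : Circle) : dist w (w * z) = ‖1 - (z : ℂ)‖ := by
  rw [circle_dist_eq, Circle.coe_mul, ← mul_one_sub, norm_mul, Circle.norm_coe, one_mul]

theorem circle_dist_inv (x y : Circle) : dist x⁻¹ y⁻¹ = dist x y := by
  rw [circle_dist_eq, circle_dist_eq, Circle.coe_inv_eq_conj, Circle.coe_inv_eq_conj, ← map_sub,
    Complex.norm_conj]

theorem circle_dist_le_two (x y : Circle) : dist x y ≤ 2 := by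
  rw [circle_dist_eq]
  refine (norm_sub_le _ _).trans ?_
  rw [Circle.norm_coe, Circle.norm_coe]; norm_num

/-- On the circle, whose diameter is `2`, Lipschitz bounds imply Hölder bounds. -/
theorem circle_dist_le_rpow {γ : ℝ≥0} (hγ : γ ≤ 1) (x y : Circle) :
    dist x y ≤ 2 * dist x y ^ (γ : ℝ) := by
  have hγ' : (γ : ℝ) ≤ 1 := by exact_mod_cast hγ
  rcases (dist_nonneg (x := x) (y := y)).eq_or_lt with h | h
  · rw [← h]; positivity
  · have h1 : dist x y = dist x y ^ (1 - γ : ℝ) * dist x y ^ (γ : ℝ) := by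
      rw [← Real.rpow_add h]; simp
    have h2 : dist x y ^ (1 - γ : ℝ) ≤ 2 := by
      calc dist x y ^ (1 - γ : ℝ) ≤ (2 : ℝ) ^ (1 - γ : ℝ) :=
            Real.rpow_le_rpow h.le (circle_dist_le_two x y) (by linarith)
        _ ≤ (2 : ℝ) ^ (1 : ℝ) :=
            Real.rpow_le_rpow_of_exponent_le (by norm_num) (by linarith [γ.coe_nonneg])
        _ = 2 := by norm_num
    calc dist x y = dist x y ^ (1 - γ : ℝ) * dist x y ^ (γ : ℝ) := h1
      _ ≤ _ := by gcongr

theorem norm_one_sub_circleExp (t : ℝ) :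
    ‖1 - (Circle.exp t : ℂ)‖ = 2 * |Real.sin (t / 2)| := by
  rw [norm_sub_rev, Circle.coe_exp, mul_comm, Complex.norm_exp_I_mul_ofReal_sub_one, norm_mul,
    Real.norm_eq_abs, Real.norm_eq_abs, abs_two]

theorem abs_le_norm_one_sub_circleExp {t : ℝ} (ht : |t| ≤ Real.pi) :
    |t| ≤ Real.pi / 2 * ‖1 - (Circle.exp t : ℂ)‖ := by
  have h := Real.mul_abs_le_abs_sin (x := t / 2) (by rw [abs_div, abs_two]; linarith)
  rw [norm_one_sub_circleExp]
  rw [abs_div, abs_two] at h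
  have hpi := Real.pi_pos
  have h2 := mul_le_mul_of_nonneg_left h hpi.le
  rw [show Real.pi * (2 / Real.pi * (|t| / 2)) = |t| by field_simp] at h2
  linarith

/-- Every point of the circle is `e^{it}` with `|t| ≤ π`. -/
theorem exists_circleExp_eq (z : Circle) : ∃ t : ℝ, |t| ≤ Real.pi ∧ Circle.exp t = z :=
  ⟨Complex.arg z, Complex.abs_arg_le_pi z, Circle.exp_arg z⟩

theorem hasDerivAt_comp_mul_exp {f : Circle → ℂ} {w : Circle} {s : ℝ}
    (hf : DiffAt f (w * Circle.exp s)) :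
    HasDerivAt (fun η : ℝ => f (w * Circle.exp η))
      (Complex.I * ((w * Circle.exp s : Circle) * dw f (w * Circle.exp s))) s := by
  have h1 : HasDerivAt (fun η : ℝ => f (w * Circle.exp s * Circle.exp η))
      (deriv (fun η : ℝ => f (w * Circle.exp s * Circle.exp η)) 0) (s - s) := by
    rw [sub_self]; exact hf.hasDerivAt
  have h2 := h1.comp_sub_const s s
  have h3 : (fun η : ℝ => f (w * Circle.exp s * Circle.exp (η - s))) =
      fun η => f (w * Circle.exp η) := by
    funext η
    rw [mul_assoc, ← Circle.exp_add, add_sub_cancel]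
  rw [h3] at h2
  refine h2.congr_deriv ?_
  have h4 : ((w * Circle.exp s : Circle) : ℂ) * conj ((w * Circle.exp s : Circle) : ℂ) = 1 := by
    rw [Complex.mul_conj, Circle.normSq_coe, Complex.ofReal_one]
  unfold dw
  linear_combination (Complex.I ^ 2 *
    deriv (fun η : ℝ => f (w * Circle.exp s * Circle.exp η)) 0) * h4 +
    deriv (fun η : ℝ => f (w * Circle.exp s * Circle.exp η)) 0 * Complex.I_sq

theorem self_le_sin_mul {x : ℝ} (h0 : 0 ≤ x) (h1 : x ≤ Real.pi / 2) :
    x ≤ Real.sin x * (1 + x) := by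
  rcases h0.eq_or_lt with rfl | h0
  · simp
  have h2 := Real.sin_gt_sub_cube h0
  have h3 : x ≤ 2 := by linarith [Real.pi_le_four]
  have h4 : (x - x ^ 3 / 6) * (1 + x) ≤ Real.sin x * (1 + x) := by gcongr
  have h5 : 0 ≤ x ^ 2 * (2 - x) * (3 + x) := by
    have : 0 ≤ 2 - x := by linarith
    positivity
  nlinarith

namespace HolderOne

variable {γ : ℝ≥0}

theorem diffAt (f : HolderOne γ) (w : Circle) : DiffAt f w := f.2.1 w

theorem norm_apply_le (f : HolderOne γ) (w : Circle) : ‖f w‖ ≤ ‖f‖ := by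
  have h := (toCM f).norm_coe_le_norm w
  have h2 := norm_nonneg (deriv f)
  rw [norm_def]; linarith

theorem norm_toCM_deriv_le (f : HolderOne γ) : ‖Holder.toCM (deriv f)‖ ≤ ‖deriv f‖ := by
  rw [Holder.norm_def]
  exact le_add_of_nonneg_right (by positivity)

theorem norm_deriv_le (f : HolderOne γ) : ‖deriv f‖ ≤ ‖f‖ := by
  rw [norm_def]
  exact le_add_of_nonneg_left (by positivity)

theorem norm_dw_le (f : HolderOne γ) (w : Circle) : ‖dw f w‖ ≤ ‖deriv f‖ :=
  ((Holder.toCM (deriv f)).norm_coe_le_norm w).trans f.norm_toCM_deriv_le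

theorem norm_dw_sub_le (f : HolderOne γ) (x y : Circle) :
    ‖dw f x - dw f y‖ ≤ nnHolderNorm γ (dw f) * dist x y ^ (γ : ℝ) :=
  norm_sub_le_of_memHolder f.2.2.2 x y

/-- The function `w ↦ w f'(w) = -i g'(η)` has Hölder norm controlled by that of `f'`. -/
theorem norm_mul_dw_sub_le (hγ : γ ≤ 1) (f : HolderOne γ) (x y : Circle) :
    ‖(x : ℂ) * dw f x - y * dw f y‖ ≤ 2 * ‖f‖ * dist x y ^ (γ : ℝ) := by
  have h1 : (x : ℂ) * dw f x - y * dw f y = x * (dw f x - dw f y) + (x - y) * dw f y := by ring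
  have h2 : ‖dw f y‖ ≤ ‖Holder.toCM (deriv f)‖ := (Holder.toCM (deriv f)).norm_coe_le_norm y
  have h3 := f.norm_dw_sub_le x y
  have h4 : (nnHolderNorm γ (dw f) : ℝ) + ‖Holder.toCM (deriv f)‖ ≤ ‖f‖ := by
    refine le_trans (le_of_eq ?_) f.norm_deriv_le
    rw [Holder.norm_def, add_comm]
    rfl
  have h5 : 0 ≤ dist x y ^ (γ : ℝ) := by positivity
  have h6 := circle_dist_le_rpow hγ x y
  have h7 : ‖((x : ℂ) - y)‖ * ‖dw f y‖ ≤ 2 * dist x y ^ (γ : ℝ) * ‖Holder.toCM (deriv f)‖ := by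
    rw [← circle_dist_eq]
    exact mul_le_mul h6 h2 (norm_nonneg _) (by positivity)
  rw [h1]
  refine (norm_add_le _ _).trans ?_
  rw [norm_mul, norm_mul, Circle.norm_coe, one_mul]
  have h8 := mul_le_mul_of_nonneg_right h4 h5
  have h9 : 0 ≤ (nnHolderNorm γ (dw f) : ℝ) * dist x y ^ (γ : ℝ) := by positivity
  nlinarith

/-- The chordal Lipschitz constant of `f` is at most its `C^{1+γ}` norm. The arc-length estimate
`|f(w) - f(wz)| ≤ |t| ‖f'‖_∞`, `z = e^{it}`, loses the factor arc/chord, which is made up for by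
`|f(w) - f(wz)| ≤ 2 ‖f‖_∞`: the two combine through `x ≤ (1 + x) sin x` for `x = |t| / 2`. -/
theorem norm_sub_mul_le (f : HolderOne γ) (w z : Circle) :
    ‖f w - f (w * z)‖ ≤ ‖f‖ * ‖1 - (z : ℂ)‖ := by
  obtain ⟨t, ht, rfl⟩ := exists_circleExp_eq z
  have hM0 := norm_nonneg (toCM f)
  have hM1 := norm_nonneg (deriv f)
  have hA : ‖f w - f (w * Circle.exp t)‖ ≤ 2 * ‖toCM f‖ := by
    refine (norm_sub_le _ _).trans ?_
    linarith [(toCM f).norm_coe_le_norm w, (toCM f).norm_coe_le_norm (w * Circle.exp t)]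
  have hB : ‖f w - f (w * Circle.exp t)‖ ≤ ‖deriv f‖ * |t| := by
    have h := convex_univ.norm_image_sub_le_of_norm_hasDerivWithin_le
      (f := fun η : ℝ => f (w * Circle.exp η)) (C := ‖deriv f‖) (x := t) (y := 0)
      (fun s _ => (hasDerivAt_comp_mul_exp (f.diffAt (w * Circle.exp s))).hasDerivWithinAt)
      (fun s _ => by
        rw [norm_mul, norm_mul, Complex.norm_I, Circle.norm_coe, one_mul, one_mul]
        exact f.norm_dw_le _) (Set.mem_univ _) (Set.mem_univ _)
    simpa using h
  have hx0 : 0 ≤ |t| / 2 := by positivity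
  have hsin := self_le_sin_mul hx0 (by linarith)
  have hs0 : 0 ≤ Real.sin (|t| / 2) :=
    Real.sin_nonneg_of_nonneg_of_le_pi hx0 (by linarith [Real.pi_pos])
  have hsabs : |Real.sin (t / 2)| = Real.sin (|t| / 2) := by
    rcases abs_cases t with ⟨h, _⟩ | ⟨h, _⟩
    · rw [h] at hs0 ⊢; exact abs_of_nonneg hs0
    · rw [h, neg_div, Real.sin_neg] at hs0 ⊢
      exact abs_of_nonpos (by linarith)
  rw [norm_one_sub_circleExp, hsabs, norm_def]
  set x := |t| / 2 with hx
  set s := Real.sin x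
  set D := ‖f w - f (w * Circle.exp t)‖
  have hB' : D ≤ 2 * x * ‖deriv f‖ := by rw [hx]; linarith
  rcases hx0.eq_or_lt with h0 | h0
  · rw [← h0] at hB'
    have : 0 ≤ (‖toCM f‖ + ‖deriv f‖) * (2 * s) := by positivity
    linarith
  · have h1 : 0 ≤ D := norm_nonneg _
    -- `x D ≤ (1 + x) s D = s (x D) + s D ≤ s (2 x ‖f‖_∞) + s (2 x ‖f'‖)`
    have h2 : x * D ≤ x * ((‖toCM f‖ + ‖deriv f‖) * (2 * s)) := by
      have h3 := mul_le_mul_of_nonneg_right hsin h1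
      have h4 := mul_le_mul_of_nonneg_left hA (mul_nonneg hs0 hx0)
      have h5 := mul_le_mul_of_nonneg_left hB' hs0
      nlinarith
    exact le_of_mul_le_mul_left h2 h0

/-- Second differences: the increments `f(w) - f(wz)` are Hölder continuous in `w`, with a constant
proportional to `|1 - z|`. -/
theorem norm_increment_sub_le (hγ : γ ≤ 1) (f : HolderOne γ) (x y z : Circle) :
    ‖(f x - f (x * z)) - (f y - f (y * z))‖ ≤
      Real.pi * ‖f‖ * dist x y ^ (γ : ℝ) * ‖1 - (z : ℂ)‖ := by
  obtain ⟨t, ht, rfl⟩ := exists_circleExp_eq z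
  have h := convex_univ.norm_image_sub_le_of_norm_hasDerivWithin_le
    (f := fun η : ℝ => f (x * Circle.exp η) - f (y * Circle.exp η))
    (C := 2 * ‖f‖ * dist x y ^ (γ : ℝ)) (x := t) (y := 0)
    (fun s _ => ((hasDerivAt_comp_mul_exp (f.diffAt (x * Circle.exp s))).sub
      (hasDerivAt_comp_mul_exp (f.diffAt (y * Circle.exp s)))).hasDerivWithinAt)
    (fun s _ => by
      rw [← mul_sub, norm_mul, Complex.norm_I, one_mul]
      refine (f.norm_mul_dw_sub_le hγ _ _).trans (le_of_eq ?_)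
      rw [circle_dist_mul_right]) (Set.mem_univ _) (Set.mem_univ _)
  have h' : ‖(f x - f (x * Circle.exp t)) - (f y - f (y * Circle.exp t))‖ ≤
      2 * ‖f‖ * dist x y ^ (γ : ℝ) * |t| := by
    convert h using 1
    · simp only [Circle.exp_zero, mul_one]
      congr 1; ring
    · simp
  refine h'.trans ?_
  have h2 := abs_le_norm_one_sub_circleExp ht
  have h3 : 0 ≤ 2 * ‖f‖ * dist x y ^ (γ : ℝ) := by positivity
  have h4 := mul_le_mul_of_nonneg_left h2 h3
  linarith

end HolderOne

/-! ### The linear operators that build the functional -/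

/-- A continuous linear map into `C^γ(𝕋, V)` from a linear family of functions with uniform sup and
Hölder bounds. -/
def HolderAlg.liftL {γ : ℝ≥0} {V F : Type*} [NormedCommRing V] [NormedAlgebra ℝ V]
    [NormedAddCommGroup F] [NormedSpace ℝ F] (hγ : 0 < γ) (T : F → Circle → V) {A B : ℝ}
    (hA : 0 ≤ A) (hB : 0 ≤ B) (hadd : ∀ f g w, T (f + g) w = T f w + T g w)
    (hsmul : ∀ (c : ℝ) f w, T (c • f) w = c • T f w) (h1 : ∀ f w, ‖T f w‖ ≤ A * ‖f‖)
    (h2 : ∀ f x y, ‖T f x - T f y‖ ≤ B * ‖f‖ * dist x y ^ (γ : ℝ)) : F →L[ℝ] HolderAlg γ V :=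
  LinearMap.mkContinuous
    { toFun := fun f => HolderAlg.mk hγ (T f) (B * ‖f‖) (by positivity) (h2 f)
      map_add' := fun f g => HolderAlg.ext fun w => by
        rw [HolderAlg.add_apply]; exact hadd f g w
      map_smul' := fun c f => HolderAlg.ext fun w => by
        rw [RingHom.id_apply, HolderAlg.smul_apply]; exact hsmul c f w } (A + B) fun f => by
    rw [add_mul]
    exact HolderAlg.norm_le (by positivity) (by positivity) (h1 f) (h2 f)

/-- The parameter interval `(0, 2π)`: the point `τ = w e^{is}` runs through `𝕋 \ {w}`. -/
abbrev Arc : Type := Set.Ioo (0 : ℝ) (2 * Real.pi)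

/-- Lebesgue measure on `(0, 2π)`. -/
instance : MeasureSpace Arc := Measure.Subtype.measureSpace

theorem one_sub_exp_ne_zero (s : Arc) : (1 : ℂ) - (Circle.exp s : ℂ) ≠ 0 := by
  intro h
  have h1 : ‖(1 : ℂ) - (Circle.exp s : ℂ)‖ = 0 := by rw [h, norm_zero]
  rw [norm_one_sub_circleExp] at h1
  have h2 : 0 < Real.sin ((s : ℝ) / 2) :=
    Real.sin_pos_of_pos_of_lt_pi (by linarith [s.2.1]) (by linarith [s.2.2])
  have h3 : 0 < |Real.sin ((s : ℝ) / 2)| := abs_pos.2 h2.ne'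
  linarith

theorem continuous_coe_circleExp : Continuous fun t : ℝ => (Circle.exp t : ℂ) :=
  continuous_induced_dom.comp Circle.exp.continuous

namespace HolderOne

variable {γ : ℝ≥0}

@[simp] theorem add_apply (f g : HolderOne γ) (w : Circle) : (f + g) w = f w + g w := by
  rw [map_add]; rfl

@[simp] theorem smul_apply (c : ℝ) (f : HolderOne γ) (w : Circle) : (c • f) w = c • f w := by
  rw [map_smul]; rfl

theorem dw_add_apply (f g : HolderOne γ) (w : Circle) : dw (f + g : HolderOne γ) w =
    dw f w + dw g w := by
  rw [map_add]; exact dw_add (f.diffAt w) (g.diffAt w)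

theorem dw_smul_apply (c : ℝ) (f : HolderOne γ) (w : Circle) : dw (c • f : HolderOne γ) w =
    c • dw f w := by
  rw [map_smul]; exact dw_smul c (f.diffAt w)

theorem continuous_dw (f : HolderOne γ) : Continuous (dw f) := f.2.2.1

/-- The inclusion `C^{1+γ}(𝕋) → C^γ(𝕋)`. -/
def inclL (hγ : 0 < γ) (hγ1 : γ ≤ 1) : HolderOne γ →L[ℝ] HolderAlg γ ℂ :=
  HolderAlg.liftL hγ (fun f w => f w) (A := 1) (B := 2) zero_le_one zero_le_two add_apply smul_apply
    (fun f w => by rw [one_mul]; exact f.norm_apply_le w) fun f x y => by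
      have h := f.norm_sub_mul_le x (x⁻¹ * y)
      rw [← circle_dist_self_mul x, mul_inv_cancel_left] at h
      have h2 := mul_le_mul_of_nonneg_left (circle_dist_le_rpow hγ1 x y) (norm_nonneg f)
      linarith

/-- The derivative `C^{1+γ}(𝕋) → C^γ(𝕋)`. -/
def dwL (hγ : 0 < γ) : HolderOne γ →L[ℝ] HolderAlg γ ℂ :=
  HolderAlg.liftL hγ (fun f w => dw f w) (A := 1) (B := 1) zero_le_one zero_le_one dw_add_apply
    dw_smul_apply (fun f w => by rw [one_mul]; exact (f.norm_dw_le w).trans f.norm_deriv_le)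
    fun f x y => by
      refine (f.norm_dw_sub_le x y).trans ?_
      gcongr
      rw [one_mul]
      refine le_trans ?_ f.norm_deriv_le
      rw [Holder.norm_def]
      exact le_add_of_nonneg_left (norm_nonneg _)

/-- The difference quotients `s ↦ (f(w) - f(w e^{is})) / (1 - e^{is})`. -/
def quot (f : HolderOne γ) (w : Circle) : Arc →ᵇ ℂ :=
  ofNormedAddCommGroup (fun s : Arc => (f w - f (w * Circle.exp s)) / (1 - (Circle.exp s : ℂ)))
    (by
      refine Continuous.div ?_ ?_ one_sub_exp_ne_zero
      · exact continuous_const.sub ((toCM f).continuous.comp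
          (continuous_const.mul (Circle.exp.continuous.comp continuous_subtype_val)))
      · exact continuous_const.sub (continuous_coe_circleExp.comp continuous_subtype_val))
    ‖f‖ fun s => by
      rw [norm_div, div_le_iff₀ (norm_pos_iff.2 (one_sub_exp_ne_zero s))]
      exact f.norm_sub_mul_le w _

theorem quot_apply (f : HolderOne γ) (w : Circle) (s : Arc) :
    quot f w s = (f w - f (w * Circle.exp s)) / (1 - (Circle.exp s : ℂ)) := rfl

/-- The family of difference quotients as an operator `C^{1+γ}(𝕋) → C^γ(𝕋, C_b(0, 2π))`. -/
def quotL (hγ : 0 < γ) (hγ1 : γ ≤ 1) : HolderOne γ →L[ℝ] HolderAlg γ (Arc →ᵇ ℂ) :=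
  HolderAlg.liftL hγ quot (A := 1) (B := Real.pi) zero_le_one Real.pi_pos.le
    (fun f g w => by
      ext s
      rw [BoundedContinuousFunction.add_apply, quot_apply, quot_apply, quot_apply, add_apply,
        add_apply]
      ring)
    (fun c f w => by
      ext s
      rw [BoundedContinuousFunction.smul_apply, quot_apply, quot_apply, smul_apply,
        smul_apply, ← smul_sub, smul_div_assoc])
    (fun f w => by
      rw [one_mul]
      exact norm_ofNormedAddCommGroup_le _ (norm_nonneg f) _)
    fun f x y => by
      refine (BoundedContinuousFunction.norm_le (by positivity)).2 fun s => ?_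
      rw [BoundedContinuousFunction.sub_apply, quot_apply, quot_apply, ← sub_div, norm_div,
        div_le_iff₀ (norm_pos_iff.2 (one_sub_exp_ne_zero s))]
      exact f.norm_increment_sub_le hγ1 x y _

/-- The rotated densities `s ↦ w e^{is} f'(w e^{is})`. -/
def density (f : HolderOne γ) (w : Circle) : Arc →ᵇ ℂ :=
  ofNormedAddCommGroup
    (fun s : Arc => ((w * Circle.exp s : Circle) : ℂ) * dw f (w * Circle.exp s))
    (by
      have h : Continuous fun s : Arc => w * Circle.exp s :=
        continuous_const.mul (Circle.exp.continuous.comp continuous_subtype_val)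
      exact (continuous_induced_dom.comp h).mul (f.continuous_dw.comp h))
    ‖f‖ fun s => by
      rw [norm_mul, Circle.norm_coe, one_mul]
      exact (f.norm_dw_le _).trans f.norm_deriv_le

theorem density_apply (f : HolderOne γ) (w : Circle) (s : Arc) :
    density f w s = ((w * Circle.exp s : Circle) : ℂ) * dw f (w * Circle.exp s) := rfl

/-- The family of rotated densities as an operator `C^{1+γ}(𝕋) → C^γ(𝕋, C_b(0, 2π))`. -/
def densityL (hγ : 0 < γ) (hγ1 : γ ≤ 1) : HolderOne γ →L[ℝ] HolderAlg γ (Arc →ᵇ ℂ) :=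
  HolderAlg.liftL hγ density (A := 1) (B := 2) zero_le_one zero_le_two
    (fun f g w => by
      ext s
      rw [BoundedContinuousFunction.add_apply, density_apply, density_apply, density_apply,
        dw_add_apply, mul_add])
    (fun c f w => by
      ext s
      rw [BoundedContinuousFunction.smul_apply, density_apply, density_apply, dw_smul_apply,
        mul_smul_comm])
    (fun f w => by
      rw [one_mul]
      exact norm_ofNormedAddCommGroup_le _ (norm_nonneg f) _)
    fun f x y => by
      refine (BoundedContinuousFunction.norm_le (by positivity)).2 fun s => ?_
      rw [BoundedContinuousFunction.sub_apply, density_apply, density_apply]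
      refine (f.norm_mul_dw_sub_le hγ1 _ _).trans (le_of_eq ?_)
      rw [circle_dist_mul_right]

end HolderOne

/-! ### Integration against the singular weight -/

/-- The weight `|1 - e^{it}|^{-α}`. -/
def weight (α t : ℝ) : ℝ := ‖1 - (Circle.exp t : ℂ)‖ ^ (-α)

theorem weight_nonneg (α t : ℝ) : 0 ≤ weight α t := by unfold weight; positivity

theorem measurable_weight (α : ℝ) : Measurable (weight α) := by
  have h : Measurable fun t : ℝ => ‖1 - (Circle.exp t : ℂ)‖ :=
    (continuous_const.sub continuous_coe_circleExp).norm.measurable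
  exact h.pow_const _

theorem intervalIntegrable_weight {α : ℝ} (hα0 : 0 < α) (hα1 : α < 1) :
    IntervalIntegrable (weight α) volume 0 (2 * Real.pi) := by
  have hpi := Real.pi_pos
  have h1 : IntervalIntegrable (weight α) volume 0 Real.pi := by
    have h := (intervalIntegral.intervalIntegrable_rpow' (a := 0) (b := Real.pi) (r := -α)
      (by linarith)).const_mul ((Real.pi / 2) ^ α)
    refine h.mono_fun' (measurable_weight α).aestronglyMeasurable ?_
    refine (ae_restrict_iff' measurableSet_uIoc).2 (Filter.Eventually.of_forall fun t ht => ?_)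
    rw [Set.uIoc_of_le hpi.le] at ht
    simp only [Real.norm_of_nonneg (weight_nonneg α t)]
    have h2 := abs_le_norm_one_sub_circleExp (t := t) (by rw [abs_of_pos ht.1]; exact ht.2)
    rw [abs_of_pos ht.1] at h2
    have h3 : t / (Real.pi / 2) ≤ ‖1 - (Circle.exp t : ℂ)‖ := by
      rw [div_le_iff₀ (by positivity)]; linarith
    have h4 : 0 < t / (Real.pi / 2) := div_pos ht.1 (by positivity)
    refine (Real.rpow_le_rpow_of_nonpos h4 h3 (by linarith)).trans (le_of_eq ?_)
    rw [Real.div_rpow ht.1.le (by positivity), Real.rpow_neg (by positivity : 0 ≤ Real.pi / 2),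
      div_inv_eq_mul, mul_comm]
  have h2 : IntervalIntegrable (weight α) volume (2 * Real.pi - 0) (2 * Real.pi - Real.pi) := by
    refine (h1.comp_sub_left (2 * Real.pi)).congr fun t _ => ?_
    simp only [weight, norm_one_sub_circleExp]
    rw [show (2 * Real.pi - t) / 2 = Real.pi - t / 2 by ring, Real.sin_pi_sub]
  rw [sub_zero, show 2 * Real.pi - Real.pi = Real.pi by ring] at h2
  exact h1.trans h2.symm

theorem integrable_weight {α : ℝ} (hα0 : 0 < α) (hα1 : α < 1) :
    Integrable fun s : Arc => weight α s := by
  have h := (intervalIntegrable_iff_integrableOn_Ioo_of_le (by positivity)).1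
    (intervalIntegrable_weight hα0 hα1)
  exact (integrableOn_iff_comap_subtypeVal measurableSet_Ioo).1 h

theorem integrable_weight_smul {α : ℝ} (hα0 : 0 < α) (hα1 : α < 1) (v : Arc →ᵇ ℂ) :
    Integrable fun s : Arc => weight α s • v s := by
  refine ((integrable_weight hα0 hα1).mul_const ‖v‖).mono' ?_ ?_
  · exact ((measurable_weight α).comp measurable_subtype_coe).aestronglyMeasurable.smul
      v.continuous.aestronglyMeasurable
  · refine Filter.Eventually.of_forall fun s => ?_
    rw [norm_smul, Real.norm_of_nonneg (weight_nonneg α s)]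
    exact mul_le_mul_of_nonneg_left (v.norm_coe_le_norm s) (weight_nonneg α s)

/-- The functional `v ↦ (1 / 2π) ∫_0^{2π} |1 - e^{is}|^{-α} v(s) ds` on `C_b(0, 2π)`. -/
def weightIntegral {α : ℝ} (hα0 : 0 < α) (hα1 : α < 1) : (Arc →ᵇ ℂ) →L[ℝ] ℂ :=
  LinearMap.mkContinuous
    { toFun := fun v => (2 * Real.pi)⁻¹ • ∫ s : Arc, weight α s • v s
      map_add' := fun v v' => by
        rw [← smul_add, ← integral_add (integrable_weight_smul hα0 hα1 v)
          (integrable_weight_smul hα0 hα1 v')]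
        simp only [BoundedContinuousFunction.add_apply, smul_add]
      map_smul' := fun c v => by
        rw [RingHom.id_apply, smul_comm c, ← integral_smul c]
        simp only [BoundedContinuousFunction.smul_apply, smul_comm c] }
    ((2 * Real.pi)⁻¹ * ∫ s : Arc, weight α s) fun v => by
    change ‖(2 * Real.pi)⁻¹ • ∫ s : Arc, weight α s • v s‖ ≤ _
    rw [norm_smul, Real.norm_of_nonneg (by positivity), mul_assoc, ← integral_mul_const]
    refine mul_le_mul_of_nonneg_left ?_ (by positivity)
    refine norm_integral_le_of_norm_le ((integrable_weight hα0 hα1).mul_const ‖v‖)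
      (Filter.Eventually.of_forall fun s => ?_)
    rw [norm_smul, Real.norm_of_nonneg (weight_nonneg α s)]
    exact mul_le_mul_of_nonneg_left (v.norm_coe_le_norm s) (weight_nonneg α s)

theorem weightIntegral_apply {α : ℝ} (hα0 : 0 < α) (hα1 : α < 1) (v : Arc →ᵇ ℂ) :
    weightIntegral hα0 hα1 v = (2 * Real.pi)⁻¹ • ∫ s : Arc, weight α s • v s := rfl

/-! ### Circle means -/

theorem circleMean_eq (f : Circle → ℂ) :
    circleMean f = (2 * Real.pi)⁻¹ • ∫ η in (0 : ℝ)..(2 * Real.pi),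
      f (Circle.exp η) * (Circle.exp η : ℂ) := by
  unfold circleMean
  have h : (fun η : ℝ => f (Circle.exp η) * (Complex.I * (Circle.exp η : ℂ))) =
      fun η => Complex.I * (f (Circle.exp η) * (Circle.exp η : ℂ)) := by
    funext η; ring
  rw [h, intervalIntegral.integral_const_mul, ← mul_assoc, Complex.real_smul]
  congr 1
  have := Real.pi_pos.ne'
  push_cast
  field_simp

theorem circleMean_eq_rotate (f : Circle → ℂ) (w : Circle) :
    circleMean f = (2 * Real.pi)⁻¹ • ∫ t in (0 : ℝ)..(2 * Real.pi),
      f (w * Circle.exp t) * ((w * Circle.exp t : Circle) : ℂ) := by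
  obtain ⟨x, -, rfl⟩ := exists_circleExp_eq w
  rw [circleMean_eq]
  congr 1
  simp only [← Circle.exp_add]
  rw [intervalIntegral.integral_comp_add_left
    (fun η : ℝ => f (Circle.exp η) * (Circle.exp η : ℂ)) x, add_zero]
  have hp : Function.Periodic (fun η : ℝ => f (Circle.exp η) * (Circle.exp η : ℂ))
      (2 * Real.pi) := fun η => by simp only [Circle.exp_add_two_pi]
  have h := hp.intervalIntegral_add_eq 0 x
  rw [zero_add] at h
  exact h

theorem intervalIntegral_conj (h : ℝ → ℂ) {a b : ℝ} (hab : a ≤ b) :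
    ∫ η in a..b, conj (h η) = conj (∫ η in a..b, h η) := by
  rw [intervalIntegral.integral_of_le hab, intervalIntegral.integral_of_le hab]
  exact integral_conj

theorem circleMean_conj_inv (f : Circle → ℂ) :
    circleMean (fun τ => conj (f τ⁻¹)) = conj (circleMean f) := by
  rw [circleMean_eq, circleMean_eq, Complex.real_smul, Complex.real_smul, map_mul,
    Complex.conj_ofReal, ← intervalIntegral_conj _ (by positivity)]
  congr 1
  have h := intervalIntegral.integral_comp_sub_left (a := 0) (b := 2 * Real.pi)
    (fun η : ℝ => conj (f (Circle.exp η) * (Circle.exp η : ℂ))) (2 * Real.pi)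
  rw [sub_self, sub_zero] at h
  rw [← h]
  congr 1
  funext η
  have h1 : Circle.exp (2 * Real.pi - η) = (Circle.exp η)⁻¹ := by
    rw [Circle.exp_sub, Circle.exp_two_pi, one_div]
  rw [h1, map_mul, Circle.coe_inv_eq_conj, Complex.conj_conj]

/-! ### Fourier coefficients -/

theorem fourierCoef_conj_inv (f : Circle → ℂ) (n : ℤ) :
    fourierCoef (fun w => conj (f w⁻¹)) n = conj (fourierCoef f n) := by
  unfold fourierCoef
  rw [← circleMean_conj_inv]
  congr 1
  funext w
  rw [map_mul, map_zpow₀, Circle.coe_inv_eq_conj, Complex.conj_conj]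

theorem fourierCoef_eq (f : Circle → ℂ) (n : ℤ) :
    fourierCoef f n = (2 * Real.pi)⁻¹ • ∫ η in (0 : ℝ)..(2 * Real.pi),
      f (Circle.exp η) * (Circle.exp η : ℂ) ^ (-n) := by
  unfold fourierCoef
  rw [circleMean_eq]
  congr 2
  funext η
  rw [mul_assoc, ← zpow_add_one₀ (Circle.coe_ne_zero _)]
  congr 2
  ring

theorem fourierCoef_conj_neg (f : Circle → ℂ) (n : ℤ) :
    fourierCoef (fun w => conj (f w)) (-n) = conj (fourierCoef f n) := by
  rw [fourierCoef_eq, fourierCoef_eq, Complex.real_smul, Complex.real_smul, map_mul,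
    Complex.conj_ofReal, ← intervalIntegral_conj _ (by positivity)]
  congr 2
  funext η
  rw [map_mul, map_zpow₀, ← Circle.coe_inv_eq_conj, Circle.coe_inv, inv_zpow', neg_neg]

/-- A continuous function on the circle is determined by its Fourier coefficients. -/
theorem eq_zero_of_fourierCoef (f : C(Circle, ℂ)) (hf : ∀ n, fourierCoef f n = 0) : f = 0 := by
  have : Fact (0 < 2 * Real.pi) := ⟨Real.two_pi_pos⟩
  let g : C(AddCircle (2 * Real.pi), ℂ) :=
    f.comp ⟨AddCircle.toCircle, AddCircle.continuous_toCircle⟩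
  have hpi : 2 * Real.pi ≠ 0 := Real.two_pi_pos.ne'
  have hg : ∀ x : ℝ, g (x : AddCircle (2 * Real.pi)) = f (Circle.exp x) := fun x => by
    change f (AddCircle.toCircle (x : AddCircle (2 * Real.pi))) = _
    rw [AddCircle.toCircle_apply_mk, div_self hpi, one_mul]
  have hc : fourierCoeff g = 0 := by
    funext n
    rw [fourierCoeff_eq_intervalIntegral g n 0, zero_add, Pi.zero_apply, ← hf n, fourierCoef_eq,
      one_div]
    congr 2
    funext x
    rw [hg, smul_eq_mul, mul_comm, fourier_coe_apply, Circle.coe_exp, ← Complex.exp_int_mul]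
    congr 2
    have h1 : (Real.pi : ℂ) ≠ 0 := by exact_mod_cast Real.pi_pos.ne'
    push_cast
    field_simp
  have hsum := hasSum_fourier_series_of_summable (f := g) (by rw [hc]; exact summable_zero)
  have hg0 : g = 0 := by
    refine hsum.unique ?_
    simp only [hc, Pi.zero_apply, zero_smul]
    exact hasSum_zero
  ext w
  obtain ⟨x, -, rfl⟩ := exists_circleExp_eq w
  rw [← hg x, hg0]
  rfl

/-- Functions in `X` commute with complex conjugation, since their Fourier coefficients are real. -/
theorem X_apply_inv {α : ℝ} (f : X α) (w : Circle) : f.1 w⁻¹ = conj (f.1 w) := by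
  let g : C(Circle, ℂ) := ⟨fun w => conj (f.1 w⁻¹),
    Complex.continuous_conj.comp ((HolderOne.toCM f.1).continuous.comp continuous_inv)⟩
  have h : g + (-1 : ℝ) • HolderOne.toCM f.1 = 0 := by
    refine eq_zero_of_fourierCoef _ fun n => ?_
    rw [fourierCoef_add, fourierCoef_smul]
    have h1 : fourierCoef g n = conj (fourierCoef f.1 n) := fourierCoef_conj_inv _ n
    rw [h1, Complex.conj_eq_iff_im.2 (f.2 n).1]
    push_cast
    ring
  have h2 := congrArg (fun k : C(Circle, ℂ) => k w) h
  simp only [ContinuousMap.add_apply, ContinuousMap.zero_apply, neg_smul, one_smul] at h2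
  have h3 : conj (f.1 w⁻¹) = f.1 w := add_neg_eq_zero.1 h2
  rw [← h3, Complex.conj_conj]

/-! ### The odd imaginary part as a map into `Y` -/

/-- Real-valued odd functions satisfy the Fourier condition that defines `Y`. -/
theorem fourierCoef_of_real_of_odd {g : Circle → ℂ} (hr : ∀ w, conj (g w) = g w)
    (ho : ∀ w, g w⁻¹ = -g w) (n : ℤ) :
    (fourierCoef g n).re = 0 ∧ fourierCoef g (-n) = -fourierCoef g n := by
  have h1 : fourierCoef g (-n) = conj (fourierCoef g n) := by
    rw [← fourierCoef_conj_neg]; simp only [hr]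
  have h2 : conj (fourierCoef g n) = -fourierCoef g n := by
    rw [← fourierCoef_conj_inv, fourierCoef_eq, fourierCoef_eq, ← smul_neg,
      ← intervalIntegral.integral_neg]
    simp only [ho, map_neg, hr, neg_mul]
  refine ⟨?_, h1.trans h2⟩
  have h3 := congrArg Complex.re h2
  rw [Complex.conj_re, Complex.neg_re] at h3
  linarith

theorem expo_pos {α : ℝ} (hα1 : α < 1) : 0 < expo α := Real.toNNReal_pos.2 (by linarith)

theorem expo_le_one {α : ℝ} (hα0 : 0 < α) : expo α ≤ 1 := by
  unfold expo
  rw [Real.toNNReal_le_one]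
  linarith

/-- The odd part of the imaginary part. -/
def oddIm (z : Circle → ℂ) (w : Circle) : ℂ := ((((z w).im - (z w⁻¹).im) / 2 : ℝ) : ℂ)

theorem norm_oddIm_sub_le {γ : ℝ≥0} (z : HolderAlg γ ℂ) (x y : Circle) :
    ‖oddIm z x - oddIm z y‖ ≤ ‖z‖ * dist x y ^ (γ : ℝ) := by
  have h1 := (Complex.abs_im_le_norm _).trans (z.norm_apply_sub_le x y)
  have h2 := (Complex.abs_im_le_norm _).trans (z.norm_apply_sub_le x⁻¹ y⁻¹)
  rw [circle_dist_inv] at h2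
  rw [oddIm, oddIm, ← Complex.ofReal_sub, Complex.norm_real, Real.norm_eq_abs]
  rw [Complex.sub_im] at h1 h2
  rw [abs_le] at h1 h2 ⊢
  constructor <;> linarith

theorem norm_oddIm_le {γ : ℝ≥0} (z : HolderAlg γ ℂ) (x : Circle) : ‖oddIm z x‖ ≤ ‖z‖ := by
  have h1 := (Complex.abs_im_le_norm _).trans (z.norm_apply_le x)
  have h2 := (Complex.abs_im_le_norm _).trans (z.norm_apply_le x⁻¹)
  rw [oddIm, Complex.norm_real, Real.norm_eq_abs]
  rw [abs_le] at h1 h2 ⊢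
  constructor <;> linarith

/-- The odd part of the imaginary part, as a continuous linear map into `Y`. Composing with it turns
regularity in `C^{1-α}(𝕋)` into regularity in `Y`. -/
def oddImL {α : ℝ} (hα1 : α < 1) : HolderAlg (expo α) ℂ →L[ℝ] Y α :=
  LinearMap.mkContinuous
    { toFun := fun z => ⟨⟨⟨oddIm z, (holderWith_of_norm_le (norm_nonneg z)
          (norm_oddIm_sub_le z)).continuous (expo_pos hα1)⟩,
          memHolder_of_norm_le (norm_nonneg z) (norm_oddIm_sub_le z)⟩,
        fourierCoef_of_real_of_odd (fun _ => Complex.conj_ofReal _) fun w => by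
          change oddIm z w⁻¹ = -oddIm z w
          rw [oddIm, oddIm, inv_inv, ← Complex.ofReal_neg]
          congr 1; ring⟩
      map_add' := fun z z' => Subtype.ext (Holder.toCM_injective (ContinuousMap.ext fun w => by
        change oddIm (z + z' : HolderAlg (expo α) ℂ) w = oddIm z w + oddIm z' w
        simp only [oddIm, HolderAlg.add_apply, Complex.add_im, ← Complex.ofReal_add]
        congr 1; ring))
      map_smul' := fun c z => Subtype.ext (Holder.toCM_injective (ContinuousMap.ext fun w => by
        change oddIm (c • z : HolderAlg (expo α) ℂ) w = c • oddIm z w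
        simp only [oddIm, HolderAlg.smul_apply, Complex.real_smul, ← Complex.ofReal_mul,
          Complex.im_ofReal_mul]
        congr 1; ring)) } 2 fun z => by
    rw [two_mul]
    exact add_le_add ((ContinuousMap.norm_le _ (norm_nonneg z)).2 (norm_oddIm_le z))
      (nnHolderNorm_le_of_norm_le (norm_nonneg z) (norm_oddIm_sub_le z))

theorem oddImL_apply {α : ℝ} (hα1 : α < 1) (z : HolderAlg (expo α) ℂ) (w : Circle) :
    (oddImL hα1 z).1 w = oddIm z w := rfl

/-! ### The functional on `C^{2-α}(𝕋)` -/

open Classical in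
/-- The superposition operator `q ↦ |q|^a`, with the junk value `0` where `|q|^a` is not a Hölder
family. -/
def normRpow {γ : ℝ≥0} {S : Type*} [TopologicalSpace S] (a : ℝ) (q : HolderAlg γ (S →ᵇ ℂ)) :
    HolderAlg γ (S →ᵇ ℂ) :=
  if h : ∃ p : HolderAlg γ (S →ᵇ ℂ), ∀ w s, p w s = ((‖q w s‖ ^ a : ℝ) : ℂ) then h.choose else 0

theorem normRpow_eq {γ : ℝ≥0} {S : Type*} [TopologicalSpace S] {a : ℝ}
    {p q : HolderAlg γ (S →ᵇ ℂ)} (h : ∀ w s, p w s = ((‖q w s‖ ^ a : ℝ) : ℂ)) :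
    normRpow a q = p := by
  have h' : ∃ p : HolderAlg γ (S →ᵇ ℂ), ∀ w s, p w s = ((‖q w s‖ ^ a : ℝ) : ℂ) := ⟨p, h⟩
  rw [normRpow, dif_pos h']
  ext w s
  rw [h, h'.choose_spec]

theorem normRpow_apply {γ : ℝ≥0} {S : Type*} [TopologicalSpace S] (hγ : 0 < γ) {a : ℝ}
    (ha : a ≤ 0) {q : HolderAlg γ (S →ᵇ ℂ)} {δ : ℝ} (hδ : 0 < δ) (hq : ∀ w s, δ ≤ ‖q w s‖)
    (w : Circle) (s : S) : normRpow a q w s = ((‖q w s‖ ^ a : ℝ) : ℂ) := by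
  obtain ⟨p, hp⟩ := exists_norm_rpow hγ ha q hδ hq
  rw [normRpow_eq hp, hp]

theorem contDiffAt_normRpow {γ : ℝ≥0} {S : Type*} [TopologicalSpace S] (hγ : 0 < γ) {a : ℝ}
    (ha : a ≤ 0) {q : HolderAlg γ (S →ᵇ ℂ)} {δ : ℝ} (hδ : 0 < δ) (hq : ∀ w s, δ ≤ ‖q w s‖)
    (n : WithTop ℕ∞) : ContDiffAt ℝ n (normRpow a) q := by
  obtain ⟨N, hN, h⟩ := exists_contDiffAt_norm_rpow hγ ha q hδ hq n
  exact hN.congr_of_eventuallyEq (h.mono fun q' hq' => normRpow_eq hq')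

theorem hasDerivAt_coe_mul_exp (w : Circle) :
    HasDerivAt (fun η : ℝ => ((w * Circle.exp η : Circle) : ℂ)) (w * Complex.I) 0 := by
  have h1 : HasDerivAt (fun η : ℝ => (η : ℂ) * Complex.I) (1 * Complex.I) 0 :=
    Complex.ofRealCLM.hasDerivAt.mul_const Complex.I
  have h2 := (h1.cexp).const_mul (w : ℂ)
  simpa using h2

theorem dw_coe (w : Circle) : dw (fun w : Circle => (w : ℂ)) w = 1 := by
  unfold dw
  rw [(hasDerivAt_coe_mul_exp w).deriv]
  have h4 : (w : ℂ) * conj (w : ℂ) = 1 := by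
    rw [Complex.mul_conj, Circle.normSq_coe, Complex.ofReal_one]
  linear_combination (-Complex.I ^ 2) * h4 - Complex.I_sq

namespace HolderOne

variable {γ : ℝ≥0}

/-- The coordinate function `w ↦ w`. -/
def coord : HolderOne γ :=
  ⟨⟨fun w => (w : ℂ), continuous_induced_dom⟩, fun w => (hasDerivAt_coe_mul_exp w).differentiableAt,
    by
      have h : dw (fun w : Circle => (w : ℂ)) = fun _ => 1 := funext dw_coe
      change Continuous (dw fun w : Circle => (w : ℂ)) ∧ MemHolder γ (dw fun w : Circle => (w : ℂ))
      rw [h]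
      exact ⟨continuous_const, memHolder_const'⟩⟩

theorem coord_apply (w : Circle) : (coord : HolderOne γ) w = w := rfl

theorem coe_coord_add (f : HolderOne γ) : ((coord + f : HolderOne γ) : Circle → ℂ) = shift f := by
  funext w
  rw [add_apply]; rfl

/-- For `‖f‖ < 1` the difference quotients of `w ↦ w + f(w)` stay away from zero: that map is
bi-Lipschitz. -/
theorem one_sub_norm_le_norm_quot (f : HolderOne γ) (w : Circle) (s : Arc) :
    1 - ‖f‖ ≤ ‖quot (coord + f) w s‖ := by
  have h : quot (coord + f) w s = (w : ℂ) + quot f w s := by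
    have h0 := one_sub_exp_ne_zero s
    rw [quot_apply, quot_apply, add_apply, add_apply, coord_apply, coord_apply, Circle.coe_mul]
    field_simp
    ring
  have h1 : ‖quot f w s‖ ≤ ‖f‖ :=
    ((quot f w).norm_coe_le_norm s).trans (norm_ofNormedAddCommGroup_le _ (norm_nonneg f) _)
  have h2 := norm_sub_le ((w : ℂ) + quot f w s) (quot f w s)
  rw [add_sub_cancel_right, Circle.norm_coe] at h2
  rw [h]
  linarith

end HolderOne

/-- The integrand of the potential with the singular weight `|1 - e^{is}|^{-α}` split off. -/
def regularPart {γ : ℝ≥0} (hγ : 0 < γ) (hγ1 : γ ≤ 1) (α : ℝ) (φ : HolderOne γ) : HolderAlg γ (Arc →ᵇ ℂ) :=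
  HolderOne.densityL hγ hγ1 φ * normRpow (-α) (HolderOne.quotL hγ hγ1 φ)

theorem weight_smul_regularPart {γ : ℝ≥0} (hγ : 0 < γ) (hγ1 : γ ≤ 1) {α : ℝ} (hα0 : 0 < α)
    {φ : HolderOne γ} {δ : ℝ} (hδ : 0 < δ)
    (hφ : ∀ w s, δ ≤ ‖HolderOne.quot φ w s‖) (w : Circle) (s : Arc) :
    weight α s • regularPart hγ hγ1 α φ w s =
      kernel α φ w (w * Circle.exp s) * ((w * Circle.exp s : Circle) : ℂ) := by
  have h1 : regularPart hγ hγ1 α φ w s = HolderOne.density φ w s *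
      ((‖HolderOne.quot φ w s‖ ^ (-α) : ℝ) : ℂ) := by
    rw [regularPart, HolderAlg.mul_apply, BoundedContinuousFunction.mul_apply,
      normRpow_apply hγ (by linarith) hδ hφ w s]
    rfl
  have h2 : ‖φ w - φ (w * Circle.exp s)‖ =
      ‖HolderOne.quot φ w s‖ * ‖1 - (Circle.exp s : ℂ)‖ := by
    rw [← norm_mul, HolderOne.quot_apply, div_mul_cancel₀ _ (one_sub_exp_ne_zero s)]
  rw [h1, kernel, h2, HolderOne.density_apply, weight, Complex.real_smul,
    Real.mul_rpow (norm_nonneg _) (norm_nonneg _), Real.rpow_neg (norm_nonneg _),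
    Real.rpow_neg (norm_nonneg _), Complex.ofReal_mul, Complex.ofReal_inv, Complex.ofReal_inv,
    div_eq_mul_inv, mul_inv]
  ring

theorem intervalIntegrable_kernel {γ : ℝ≥0} (hγ : 0 < γ) (hγ1 : γ ≤ 1) {α : ℝ} (hα0 : 0 < α)
    (hα1 : α < 1) {φ : HolderOne γ} {δ : ℝ} (hδ : 0 < δ)
    (hφ : ∀ w s, δ ≤ ‖HolderOne.quot φ w s‖) (w : Circle) :
    IntervalIntegrable (fun η : ℝ => kernel α φ w (Circle.exp η)) volume 0 (2 * Real.pi) := by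
  have hpi := Real.two_pi_pos
  have h1 := integrable_weight_smul hα0 hα1 (regularPart hγ hγ1 α φ w)
  simp only [weight_smul_regularPart hγ hγ1 hα0 hδ hφ] at h1
  have h2 : IntervalIntegrable
      (fun t : ℝ => kernel α φ w (w * Circle.exp t) * ((w * Circle.exp t : Circle) : ℂ))
      volume 0 (2 * Real.pi) :=
    (intervalIntegrable_iff_integrableOn_Ioo_of_le hpi.le).2
      ((integrableOn_iff_comap_subtypeVal measurableSet_Ioo).2 h1)
  have hrot : Continuous fun t : ℝ => w * Circle.exp t :=
    continuous_const.mul Circle.exp.continuous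
  have hcont : Continuous fun t : ℝ => conj ((w * Circle.exp t : Circle) : ℂ) :=
    Complex.continuous_conj.comp (continuous_induced_dom.comp hrot)
  have h3 := h2.mul_continuousOn hcont.continuousOn
  obtain ⟨x, -, hx⟩ := exists_circleExp_eq w
  have h4 : (fun t : ℝ => kernel α φ w (w * Circle.exp t) * ((w * Circle.exp t : Circle) : ℂ) *
      conj ((w * Circle.exp t : Circle) : ℂ)) = fun t => kernel α φ w (Circle.exp (x + t)) := by
    funext t
    rw [mul_assoc, Complex.mul_conj, Circle.normSq_coe, Complex.ofReal_one, mul_one,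
      Circle.exp_add, hx]
  rw [h4] at h3
  have h5 := h3.comp_add_left (-x)
  simp only [add_neg_cancel_left, sub_neg_eq_add, zero_add] at h5
  have hp : Function.Periodic (fun η : ℝ => kernel α φ w (Circle.exp η)) (2 * Real.pi) :=
    fun η => by simp only [Circle.exp_add_two_pi]
  exact hp.intervalIntegrable hpi.ne' (t := x) (by rwa [add_comm x]) 0 (2 * Real.pi)

/-- The potential as a composition of bounded linear operators and a superposition operator. -/
theorem weightIntegral_regularPart {γ : ℝ≥0} (hγ : 0 < γ) (hγ1 : γ ≤ 1) {α : ℝ} (hα0 : 0 < α)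
    (hα1 : α < 1) {φ : HolderOne γ} {δ : ℝ} (hδ : 0 < δ)
    (hφ : ∀ w s, δ ≤ ‖HolderOne.quot φ w s‖) (w : Circle) :
    HolderAlg.mapL (weightIntegral hα0 hα1) (regularPart hγ hγ1 α φ) w =
      circleMean (kernel α φ w) := by
  rw [HolderAlg.mapL_apply, weightIntegral_apply, circleMean_eq_rotate _ w]
  simp only [weight_smul_regularPart hγ hγ1 hα0 hδ hφ]
  rw [intervalIntegral.integral_of_le Real.two_pi_pos.le, integral_Ioc_eq_integral_Ioo]
  congr 1
  exact integral_subtype_comap measurableSet_Ioo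
    (fun t : ℝ => kernel α φ w (w * Circle.exp t) * ((w * Circle.exp t : Circle) : ℂ))

theorem contDiffAt_regularPart {γ : ℝ≥0} (hγ : 0 < γ) (hγ1 : γ ≤ 1) {α : ℝ} (hα0 : 0 < α)
    {φ : HolderOne γ} {δ : ℝ} (hδ : 0 < δ)
    (hφ : ∀ w s, δ ≤ ‖HolderOne.quot φ w s‖) (n : WithTop ℕ∞) :
    ContDiffAt ℝ n (regularPart hγ hγ1 α) φ :=
  (HolderOne.densityL hγ hγ1).contDiff.contDiffAt.mul
    ((contDiffAt_normRpow hγ (by linarith) hδ hφ n).comp φ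
      (HolderOne.quotL hγ hγ1).contDiff.contDiffAt)

/-! ### Reflection symmetry -/

theorem dw_apply_inv {φ : Circle → ℂ} (h : ∀ w, φ w⁻¹ = conj (φ w)) (w : Circle) :
    dw φ w⁻¹ = conj (dw φ w) := by
  have h1 : (fun η : ℝ => φ (w⁻¹ * Circle.exp η)) =
      fun η => (fun η' : ℝ => conj (φ (w * Circle.exp η'))) (-η) := by
    funext η
    simp only [← h, mul_inv, Circle.exp_neg, inv_inv]
  have h3 : deriv (fun η : ℝ => (fun η' : ℝ => conj (φ (w * Circle.exp η'))) (-η)) 0 =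
      -deriv (fun η : ℝ => conj (φ (w * Circle.exp η))) (-0) :=
    deriv_comp_neg (fun η : ℝ => conj (φ (w * Circle.exp η))) 0
  rw [neg_zero] at h3
  have h2 : deriv (fun η : ℝ => conj (φ (w * Circle.exp η))) 0 =
      conj (deriv (fun η : ℝ => φ (w * Circle.exp η)) 0) := by
    exact deriv.star
  unfold dw
  rw [h1, h3, h2, map_mul, map_mul, map_neg, Complex.conj_I, Complex.conj_conj, Circle.coe_inv_eq_conj,
    Complex.conj_conj]
  ring

theorem G_apply_inv (α Ω : ℝ) {φ : Circle → ℂ} (h : ∀ w, φ w⁻¹ = conj (φ w)) (w : Circle) :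
    G α Ω φ w⁻¹ = -G α Ω φ w := by
  have hk : kernel α φ w⁻¹ = fun τ => conj (kernel α φ w τ⁻¹) := by
    funext τ
    unfold kernel
    have h1 : φ τ = conj (φ τ⁻¹) := by rw [← h, inv_inv]
    have h2 : dw φ τ = conj (dw φ τ⁻¹) := by rw [← dw_apply_inv h, inv_inv]
    rw [h2, h1, h w, ← map_sub, Complex.norm_conj, map_div₀, Complex.conj_ofReal]
  unfold G
  rw [hk, circleMean_conj_inv, h, dw_apply_inv h, Circle.coe_inv_eq_conj, ← Complex.conj_im]
  simp only [map_mul, map_sub, Complex.conj_ofReal, Complex.conj_conj]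

/-! ### The functional as a map `ℝ × X → Y` -/

theorem hasDerivAt_smul_add_const {E E' : Type*} [NormedAddCommGroup E] [NormedSpace ℝ E]
    [NormedAddCommGroup E'] [NormedSpace ℝ E'] (A B : E →L[ℝ] E') (t : ℝ) :
    HasDerivAt (fun s : ℝ => s • A + B) A t := by
  have h := ((hasDerivAt_id t).smul_const A).add_const B
  rwa [one_smul] at h

section Functional

variable {α : ℝ} (hα0 : 0 < α) (hα1 : α < 1)

/-- The affine map `f ↦ Id + f`. -/
def perturb (f : X α) : HolderOne (expo α) := HolderOne.coord + f.1

theorem contDiff_perturb (n : WithTop ℕ∞) : ContDiff ℝ n (perturb : X α → _) :=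
  contDiff_const.add (X α).subtypeL.contDiff

/-- Pointwise complex conjugation on `C^γ(𝕋)`. -/
def conjHolder {γ : ℝ≥0} : HolderAlg γ ℂ →L[ℝ] HolderAlg γ ℂ :=
  HolderAlg.mapL (Complex.conjCLE : ℂ →L[ℝ] ℂ)

/-- The factor `w̄ \overline{φ'(w)}`. -/
def normalFactor (φ : HolderOne (expo α)) : HolderAlg (expo α) ℂ :=
  conjHolder (HolderOne.inclL (expo_pos hα1) (expo_le_one hα0) HolderOne.coord) *
    conjHolder (HolderOne.dwL (expo_pos hα1) φ)

theorem normalFactor_apply (φ : HolderOne (expo α)) (w : Circle) :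
    normalFactor hα0 hα1 φ w = conj (w : ℂ) * conj (dw φ w) := by
  rw [normalFactor, HolderAlg.mul_apply]; rfl

theorem contDiff_normalFactor (n : WithTop ℕ∞) : ContDiff ℝ n (normalFactor hα0 hα1) :=
  contDiff_const.mul (conjHolder.contDiff.comp (HolderOne.dwL (expo_pos hα1)).contDiff)

/-- The coefficient of `Ω`: the term `Im {φ(w) w̄ \overline{φ'(w)}}`. -/
def rotationPart (f : X α) : Y α :=
  oddImL hα1 (HolderOne.inclL (expo_pos hα1) (expo_le_one hα0) (perturb f) *
    normalFactor hα0 hα1 (perturb f))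

theorem contDiff_rotationPart (n : WithTop ℕ∞) : ContDiff ℝ n (rotationPart hα0 hα1) :=
  (oddImL hα1).contDiff.comp
    (((HolderOne.inclL (expo_pos hα1) (expo_le_one hα0)).contDiff.comp (contDiff_perturb n)).mul
      ((contDiff_normalFactor hα0 hα1 n).comp (contDiff_perturb n)))

/-- The term independent of `Ω`, which contains the potential. -/
def velocityPart (f : X α) : Y α :=
  (-sqgConst α) • oddImL hα1 (HolderAlg.mapL (weightIntegral hα0 hα1)
    (regularPart (expo_pos hα1) (expo_le_one hα0) α (perturb f)) *
    normalFactor hα0 hα1 (perturb f))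

theorem le_norm_quot_perturb {f : X α} (w : Circle) (s : Arc) :
    1 - ‖f‖ ≤ ‖HolderOne.quot (perturb f) w s‖ :=
  HolderOne.one_sub_norm_le_norm_quot f.1 w s

theorem contDiffAt_velocityPart (n : WithTop ℕ∞) {f : X α} (hf : ‖f‖ < 1) :
    ContDiffAt ℝ n (velocityPart hα0 hα1) f := by
  have h1 : ContDiffAt ℝ n
      (fun f : X α => regularPart (expo_pos hα1) (expo_le_one hα0) α (perturb f)) f :=
    (contDiffAt_regularPart (expo_pos hα1) (expo_le_one hα0) hα0 (sub_pos.2 hf)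
      le_norm_quot_perturb n).comp f (contDiff_perturb n).contDiffAt
  have h2 := ((HolderAlg.mapL (weightIntegral hα0 hα1)).contDiff.contDiffAt.comp f h1).mul
    (((contDiff_normalFactor hα0 hα1 n).comp (contDiff_perturb n)).contDiffAt (x := f))
  exact ((oddImL hα1).contDiff.contDiffAt.comp f h2).const_smul (-sqgConst α)

/-- The functional `F(Ω, f)`; it is affine in `Ω`. -/
def functional (p : ℝ × X α) : Y α :=
  p.1 • rotationPart hα0 hα1 p.2 + velocityPart hα0 hα1 p.2

theorem contDiffAt_functional (n : WithTop ℕ∞) (Ω : ℝ) {f : X α} (hf : ‖f‖ < 1) :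
    ContDiffAt ℝ n (functional hα0 hα1) (Ω, f) := by
  have h1 : ContDiffAt ℝ n (fun p : ℝ × X α => p.1 • rotationPart hα0 hα1 p.2) (Ω, f) :=
    contDiffAt_fst.smul ((contDiff_rotationPart hα0 hα1 n).contDiffAt.comp (Ω, f) contDiffAt_snd)
  have h2 : ContDiffAt ℝ n (fun p : ℝ × X α => velocityPart hα0 hα1 p.2) (Ω, f) :=
    ContDiffAt.comp (g := velocityPart hα0 hα1) (Ω, f) (contDiffAt_velocityPart hα0 hα1 n hf)
      contDiffAt_snd
  exact h1.add h2

theorem functional_apply (Ω : ℝ) {f : X α} (hf : ‖f‖ < 1) (w : Circle) :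
    (functional hα0 hα1 (Ω, f)).1 w = ((G α Ω (shift f.1) w : ℝ) : ℂ) := by
  set Z : HolderAlg (expo α) ℂ :=
    (Ω • HolderOne.inclL (expo_pos hα1) (expo_le_one hα0) (perturb f) -
      sqgConst α • HolderAlg.mapL (weightIntegral hα0 hα1)
        (regularPart (expo_pos hα1) (expo_le_one hα0) α (perturb f))) *
      normalFactor hα0 hα1 (perturb f) with hZ
  have h1 : functional hα0 hα1 (Ω, f) = oddImL hα1 Z := by
    rw [hZ, sub_mul, smul_mul_assoc, smul_mul_assoc, map_sub, map_smul, map_smul, functional,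
      rotationPart, velocityPart, neg_smul, sub_eq_add_neg]
  have h2 : ∀ w, (Z w).im = G α Ω (shift f.1) w := by
    intro w
    rw [hZ, HolderAlg.mul_apply, HolderAlg.sub_apply, HolderAlg.smul_apply, HolderAlg.smul_apply,
      weightIntegral_regularPart (expo_pos hα1) (expo_le_one hα0) hα0 hα1 (sub_pos.2 hf)
      le_norm_quot_perturb, normalFactor_apply, G, ← HolderOne.coe_coord_add, Complex.real_smul,
      Complex.real_smul, mul_assoc _ (conj (w : ℂ))]
    rfl
  have h3 : ∀ w, shift f.1 w⁻¹ = conj (shift f.1 w) := by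
    intro w
    rw [shift, shift, X_apply_inv, map_add, Circle.coe_inv_eq_conj]
  rw [h1, oddImL_apply, oddIm, h2, h2, G_apply_inv α Ω h3]
  congr 1
  ring

end Functional

end

end SQGPatch

open SQGPatch

theorem proposition7p2 (α : ℝ) (hα0 : 0 < α) (hα1 : α < 1) (r : ℝ) (hr0 : 0 < r) (hr1 : r < 1) :
    -- `F(Ω, f) = G(Ω, Id + f)` is well defined on `ℝ × B_r` with values in `Y`
    ∃ F : ℝ × SQGPatch.X α → SQGPatch.Y α,
      (∀ Ω : ℝ, ∀ f ∈ Metric.ball (0 : SQGPatch.X α) r, ∀ w : Circle,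
        IntervalIntegrable
          (fun η : ℝ => SQGPatch.kernel α (SQGPatch.shift f.1) w (Circle.exp η))
          MeasureTheory.volume 0 (2 * Real.pi) ∧
        (F (Ω, f)).1 w = ((SQGPatch.G α Ω (SQGPatch.shift f.1) w : ℝ) : ℂ)) ∧
      -- (1) `F` is of class `C^1`
      ContDiffOn ℝ 1 F (Set.univ ×ˢ Metric.ball (0 : SQGPatch.X α) r) ∧
      -- (2) `L = ∂_f F` and `M = ∂_Ω ∂_f F`, with `M` continuous in the operator norm
      ∃ L M : ℝ × SQGPatch.X α → (SQGPatch.X α →L[ℝ] SQGPatch.Y α),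
        (∀ Ω : ℝ, ∀ f ∈ Metric.ball (0 : SQGPatch.X α) r,
          HasFDerivAt (fun g : SQGPatch.X α => F (Ω, g)) (L (Ω, f)) f ∧
          HasDerivAt (fun s : ℝ => L (s, f)) (M (Ω, f)) Ω) ∧
        ContinuousOn M (Set.univ ×ˢ Metric.ball (0 : SQGPatch.X α) r) := by
  have hlt : ∀ f ∈ Metric.ball (0 : X α) r, ‖f‖ < 1 := fun f hf =>
    (mem_ball_zero_iff.1 hf).trans hr1
  refine ⟨functional hα0 hα1, fun Ω f hf w => ⟨?_, functional_apply hα0 hα1 Ω (hlt f hf) w⟩,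
    fun p hp => (contDiffAt_functional hα0 hα1 1 p.1 (hlt p.2 hp.2)).contDiffWithinAt,
    fun p => p.1 • fderiv ℝ (rotationPart hα0 hα1) p.2 + fderiv ℝ (velocityPart hα0 hα1) p.2,
    fun p => fderiv ℝ (rotationPart hα0 hα1) p.2, fun Ω f hf => ⟨?_, ?_⟩, ?_⟩
  · rw [← HolderOne.coe_coord_add]
    exact intervalIntegrable_kernel (expo_pos hα1) (expo_le_one hα0) hα0 hα1
      (sub_pos.2 (hlt f hf)) le_norm_quot_perturb w
  · have h1 := ((contDiff_rotationPart hα0 hα1 1).differentiable one_ne_zero f).hasFDerivAt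
    have h2 :=
      ((contDiffAt_velocityPart hα0 hα1 1 (hlt f hf)).differentiableAt one_ne_zero).hasFDerivAt
    exact (h1.const_smul Ω).add h2
  · exact hasDerivAt_smul_add_const (fderiv ℝ (rotationPart hα0 hα1) f)
      (fderiv ℝ (velocityPart hα0 hα1) f) Ω
  · exact (((contDiff_rotationPart hα0 hα1 1).continuous_fderiv one_ne_zero).comp
      continuous_snd).continuousOn
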